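/- Let $(\Omega,\mathcal F,\mathbb P)$ be a probability space, and let $X,Y$ be random variables on it with values in $\mathcal X\subset\mathbb R^{d_x}$ and $\mathcal Y\subset\mathbb R^{d_y}$, where $\mathcal X$ is compact. Let $m\ge d_y$ and let $\tilde f:\mathbb R^m\times\mathcal X\to\mathcal Y$ be a continuous generator function for $Y|X$: if $\eta\sim\mathcal N(0,I_m)$ is independent of $X$, then $(X,\tilde f(\eta,X))$ has the law of $(X,Y)$. Let $\sigma:\mathbb R\to\mathbb R$ be a Lipschitz activation function that is not a polynomial, and let $0\le t_1<t_2\le 1$. A \emph{PSDE-BNN} with dimensions $d_h,d_w$ consists of a linear pre-processing map $a:\mathbb R^{d_x}\to\mathbb R^{d_h}$, an initial weight $w_0\in\mathbb R^{d_w}$, a division of $[0,1]$ into three regions $[0,\tau_1),[\tau_1,\tau_2),[\tau_2,1]$, a matrix $\Sigma\in\mathbb R^{d_w\times d_w}$, and two functions $f_h(t,h;w)\in\mathbb R^{d_h}$ and $f_q(t,w;\theta)\in\mathbb R^{d_w}$ which on each region are feed-forward networks with activation $\sigma$, arbitrary (finite) depth and widths, and inputs $(t,h)$ and $(t,w)$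 respectively. The parameters of $f_q$ are $\theta$; for $f_h$, each connection weight or bias is either absent (zero) or equal to a coordinate of $w$, distinct ones being distinct coordinates. Put $g_p(t)=\Sigma$ for $t\in(t_1,t_2)$ and $g_p(t)=0$ otherwise. Given a $d_w$-dimensional standard Brownian motion $B$, the dynamics on $[0,1]$ are $$\mathrm dh_t=f_h(t,h_t;w_t)\,\mathrm dt,\quad h_0=a(x),\qquad \mathrm dw_t=f_q(t,w_t;\theta)\,\mathrm dt+g_p(t)\,\mathrm dB_t,$$ started at $w_0$, where at time $t_2$ either (1) $w_{t_2}$ is the output of the SDE (no jump), or, when $t_2<1$, $w_{t_2}$ is replaced by a vector $v\in\mathbb R^{d_w}$ (with $h$ unchanged) that is (2) fixed a priori, or (3) a learnable parameter. Write $\psi_1(\omega,x)=h_1$. Then there are $D_h,D_w$ such that for all $d_h\ge D_h$, $d_w\ge D_w$, every $d_w$-dimensional standard Brownian motion $B$ on $\Omega$ independent of $X$, and every $\varepsilon>0$, the following holds in case (1), and, if $t_2<1$, also in case (2) for every $v\in\mathbb R^{d_w}$ and in case (3) for some $v\in\mathbb R^{d_w}$. There exist a PSDE-BNN with dimensions $d_h,d_w$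 whose dynamics almost surely have, for every input $x\in\mathbb R^{d_x}$, a solution with a unique final value $\psi_1(\omega,x)$, a linear map $\mathcal L:\mathbb R^{d_h}\to\mathbb R^{d_y}$, an event $A\in\mathcal F$, and a random variable $\eta\sim\mathcal N(0,I_m)$ independent of $X$ (so that $(X,\tilde f(\eta,X))$ has the law of $(X,Y)$) with $$\text{(i)}\ \ \mathbb P(A)\ge 1-\varepsilon,\qquad \text{(ii)}\ \ \forall\omega\in A,\ \forall x\in\mathcal X:\ \|\mathcal L(\psi_1(\omega,x))-\tilde f(\eta(\omega),x)\|\le\varepsilon .$$ -/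

import Mathlib

open MeasureTheory ProbabilityTheory
open scoped NNReal

/-- `ℝⁿ` with its Euclidean norm. -/
abbrev Euc (n : ℕ) : Type := EuclideanSpace ℝ (Fin n)

/-- Index set of the weights and biases of a fully connected feed-forward network with `n` inputs,
hidden layers of the listed widths, and `k` outputs: each layer with `a` inputs and `b` outputs
contributes a `b × a` weight matrix and `b` biases. -/
def ParamIdx : ℕ → List ℕ → ℕ → Type
  | n, [], k => (Fin k × Fin n) ⊕ Fin k
  | n, l :: ls, k => ((Fin l × Fin n) ⊕ Fin l) ⊕ ParamIdx l ls k

/-- The function computed by the feed-forward network with activation `σ` (applied coordinatewise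
after every layer but the last) whose weights and biases are `p`. -/
def mlp (σ : ℝ → ℝ) : (n : ℕ) → (hidden : List ℕ) → (k : ℕ) →
    (ParamIdx n hidden k → ℝ) → (Fin n → ℝ) → (Fin k → ℝ)
  | _, [], _, p, x => fun i => (∑ j, p (Sum.inl (i, j)) * x j) + p (Sum.inr i)
  | _, l :: ls, k, p, x => mlp σ l ls k (fun q => p (Sum.inr q))
      (fun i => σ ((∑ j, p (Sum.inl (Sum.inl (i, j))) * x j) + p (Sum.inl (Sum.inr i))))

/-- A standard `d`-dimensional Brownian motion: the coordinates are independent one-dimensional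
Brownian motions (with almost surely continuous paths). -/
structure IsBrownianMotion {Ω : Type*} [MeasurableSpace Ω] {d : ℕ}
    (B : ℝ≥0 → Ω → Euc d) (P : Measure Ω) : Prop where
  measurable : ∀ t, Measurable (B t)
  brownian : ∀ i : Fin d, IsBrownianReal (fun t ω => B t ω i) P
  indep : iIndepFun (fun (i : Fin d) (ω : Ω) (t : ℝ≥0) => B t ω i) P

/-- `f` is a (Gaussian noise) generator function for the conditional distribution of `Y` given `X`:
if `η ∼ N(0, I_m)` is independent of `X`, then `(X, f (η, X))` is distributed like `(X, Y)`. -/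
def IsGenerator {Ω : Type*} [MeasurableSpace Ω] (P : Measure Ω) {dx dy m : ℕ}
    {𝒳 : Set (Euc dx)} {𝒴 : Set (Euc dy)} (X : Ω → 𝒳) (Y : Ω → 𝒴) (f : Euc m × 𝒳 → 𝒴) : Prop :=
  ((P.map X).prod (stdGaussian (Euc m))).map (fun z => (z.1, f (z.2, z.1))) =
    P.map (fun ω => (X ω, Y ω))

/-- A partially stochastic infinitely deep Bayesian neural network with activation function `σ`,
input dimension `dx`, hidden dimension `dh` and weight dimension `dw`, whose weights evolve
stochastically between the cut-off times `t₁` and `t₂`.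

The time interval `[0,1]` is divided into the three regions `[0, τ₁)`, `[τ₁, τ₂)` and `[τ₂, 1]`;
on each of them the two drifts are feed-forward networks of a fixed architecture. -/
structure PSDEBNN (dx dh dw : ℕ) where
  /-- the pre-processing map -/
  a : Euc dx →ₗ[ℝ] Euc dh
  /-- the initial weight -/
  w₀ : Euc dw
  τ₁ : ℝ
  τ₂ : ℝ
  zero_lt_τ₁ : 0 < τ₁
  τ₁_lt_τ₂ : τ₁ < τ₂
  τ₂_lt_one : τ₂ < 1
  /-- hidden widths of the network `f_h` in each region -/
  hiddenH : Fin 3 → List ℕ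
  /-- In each region, the present connections (and biases) of the network `f_h` are matched
  one-to-one with coordinates of the weight vector `w_t`, where their values are read off;
  the remaining connections are absent. -/
  slot : (i : Fin 3) → ParamIdx (1 + dh) (hiddenH i) dh ≃. Fin dw
  /-- hidden widths of the network `f_q` in each region -/
  hiddenQ : Fin 3 → List ℕ
  /-- the parameters `θ` of the network `f_q` in each region -/
  θ : (i : Fin 3) → ParamIdx (1 + dw) (hiddenQ i) dw → ℝ
  /-- the value of the diffusion matrix `g_p` on the stochastic interval `(t₁, t₂)` -/
  diffusion : Matrix (Fin dw) (Fin dw) ℝ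

namespace PSDEBNN

variable {dx dh dw : ℕ}

/-- The time region to which `t` belongs. -/
noncomputable def region (M : PSDEBNN dx dh dw) (t : ℝ) : Fin 3 :=
  if t < M.τ₁ then 0 else if t < M.τ₂ then 1 else 2

/-- The drift `f_h(t, h; w)` of the hidden state: a network with input `(t, h)`
and parameters taken from `w`. -/
noncomputable def fh (M : PSDEBNN dx dh dw) (σ : ℝ → ℝ) (t : ℝ) (h : Euc dh) (w : Euc dw) :
    Euc dh :=
  WithLp.toLp 2 (mlp σ (1 + dh) (M.hiddenH (M.region t)) dh
    (fun j => ((M.slot (M.region t)) j).elim 0 (fun k => w k))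
    (Fin.append (fun _ : Fin 1 => t) (fun i => h i)))

/-- The drift `f_q(t, w; θ)` of the weights: a network with input `(t, w)` and parameters `θ`. -/
noncomputable def fq (M : PSDEBNN dx dh dw) (σ : ℝ → ℝ) (t : ℝ) (w : Euc dw) : Euc dw :=
  WithLp.toLp 2 (mlp σ (1 + dw) (M.hiddenQ (M.region t)) dw (M.θ (M.region t))
    (Fin.append (fun _ : Fin 1 => t) (fun i => w i)))

/-- The stochastic integral `∫₀ᵗ g_p dB` along the path `b` of the Brownian motion, for the
diffusion `g_p` which equals the constant matrix `M.diffusion` on `(t₁, t₂)` and vanishes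
elsewhere. -/
noncomputable def noise (M : PSDEBNN dx dh dw) (t₁ t₂ : ℝ) (b : ℝ≥0 → Euc dw) (t : ℝ) : Euc dw :=
  Matrix.toEuclideanLin M.diffusion (b (min t t₂).toNNReal - b (min t t₁).toNNReal)

/-- The equation `dw = f_q dt + g_p dB`, `w_0 = w₀`, of the weights on `[0,1]`, along the path `b`.
If `reset = none`, then `w_{t₂}` is the output of the SDE and is carried over to the ODE on
`[t₂, 1]`. If `reset = some v`, then the ODE on `[t₂, 1]` is started at `w_{t₂} = v`. -/
def WeightEq (M : PSDEBNN dx dh dw) (σ : ℝ → ℝ) (t₁ t₂ : ℝ) (b : ℝ≥0 → Euc dw) (w : ℝ → Euc dw) :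
    Option (Euc dw) → Prop
  | none => ∀ t ∈ Set.Icc (0 : ℝ) 1,
      w t = M.w₀ + (∫ s in (0 : ℝ)..t, M.fq σ s (w s)) + M.noise t₁ t₂ b t
  | some v =>
      (∀ t ∈ Set.Ico (0 : ℝ) t₂,
        w t = M.w₀ + (∫ s in (0 : ℝ)..t, M.fq σ s (w s)) + M.noise t₁ t₂ b t) ∧
      ∀ t ∈ Set.Icc t₂ 1, w t = v + ∫ s in t₂..t, M.fq σ s (w s)

/-- `(w, h)` solves, on `[0,1]` and along the path `b` of the Brownian motion, the system
`dh = f_h(t, h; w) dt`, `dw = f_q(t, w; θ) dt + g_p dB` with `h_0 = a(x)` and `w_0 = w₀`. -/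
structure IsSolution (M : PSDEBNN dx dh dw) (σ : ℝ → ℝ) (t₁ t₂ : ℝ) (reset : Option (Euc dw))
    (b : ℝ≥0 → Euc dw) (x : Euc dx) (w : ℝ → Euc dw) (h : ℝ → Euc dh) : Prop where
  integrable_fq : IntervalIntegrable (fun s => M.fq σ s (w s)) volume 0 1
  integrable_fh : IntervalIntegrable (fun s => M.fh σ s (h s) (w s)) volume 0 1
  weight_eq : M.WeightEq σ t₁ t₂ b w reset
  hidden_eq : ∀ t ∈ Set.Icc (0 : ℝ) 1, h t = M.a x + ∫ s in (0 : ℝ)..t, M.fh σ s (h s) (w s)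

/-- `ψ₁ ω x` is the value at time `1` of the hidden state with input `x`: almost surely, for every
input `x` the system has a solution, and the final hidden state of every solution is `ψ₁ ω x`. -/
def IsFinalState {Ω : Type*} [MeasurableSpace Ω] (P : Measure Ω) (B : ℝ≥0 → Ω → Euc dw)
    (M : PSDEBNN dx dh dw) (σ : ℝ → ℝ) (t₁ t₂ : ℝ) (reset : Option (Euc dw))
    (ψ₁ : Ω → Euc dx → Euc dh) : Prop :=
  ∀ᵐ ω ∂P, ∀ x : Euc dx, ∀ y : Euc dh,
    (∃ w h, M.IsSolution σ t₁ t₂ reset (fun t => B t ω) x w h ∧ h 1 = y) ↔ y = ψ₁ ω x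

end PSDEBNN

/-- With the given Brownian motion `B`, hidden dimension `dh`, weight dimension `dw` and treatment
`reset` of `w_{t₂}`, some PSDE-BNN with a linear readout `L` approximates the generator function `f`
up to `ε`, uniformly in the input and on an event of probability at least `1 - ε`. -/
def Approximable {Ω : Type*} [MeasurableSpace Ω] (P : Measure Ω) {dx dy m : ℕ}
    {𝒳 : Set (Euc dx)} {𝒴 : Set (Euc dy)} (X : Ω → 𝒳) (Y : Ω → 𝒴) (f : Euc m × 𝒳 → 𝒴)
    (σ : ℝ → ℝ) (t₁ t₂ : ℝ) (dh : ℕ) {dw : ℕ} (B : ℝ≥0 → Ω → Euc dw) (reset : Option (Euc dw))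
    (ε : ℝ) : Prop :=
  ∃ (M : PSDEBNN dx dh dw) (L : Euc dh →ₗ[ℝ] Euc dy) (ψ₁ : Ω → Euc dx → Euc dh)
    (A : Set Ω) (η : Ω → Euc m),
    PSDEBNN.IsFinalState P B M σ t₁ t₂ reset ψ₁ ∧
    MeasurableSet A ∧
    Measurable η ∧ P.map η = stdGaussian (Euc m) ∧ IndepFun η X P ∧
    P.map (fun ω => (X ω, f (η ω, X ω))) = P.map (fun ω => (X ω, Y ω)) ∧
    1 - ε ≤ P.real A ∧
    ∀ ω ∈ A, ∀ x : 𝒳, ‖L (ψ₁ ω x) - (f (η ω, x) : Euc dy)‖ ≤ ε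

/-! A single hidden neuron whose weights move in time can replace an arbitrarily wide shallow
network, so the dimensions need not grow with the accuracy.

Everything happens before `t₂`: choose `t₁ < τ₁ < τ₂ < t₂`. Up to `τ₁`, `m` coordinates of `w` carry
scaled Brownian increments, and `f_h` reads them as biases, so `h` accumulates their time integrals.
With `T = τ₁ - t₁` these integrals are independent centred Gaussians of variance `T ^ 3 / 3` before
scaling; normalized, they are the required `η`, a functional of `B` and hence independent of `X`. On
`[τ₁, τ₂)` the noise-free weight coordinates run along a prescribed curve, and the output
coordinates of `h` receive `∫ c_j(t) σ(p(t) ⬝ (x, η) + b(t)) dt`. The curve `(p, b)` passes through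
the neurons of a wide network approximating the generator, and `c` concentrates near the passage
times (`exists_curve_readout_near`). The drift `f_q` is a shallow network in `t` alone whose
primitive approximates this curve (`exists_primitive_network_near`). After `τ₂` the hidden state is
frozen, so all three treatments of `w_{t₂}` give the same final state.

The approximation is uniform on the product of `𝒳` with a ball that contains `η` with probability at
least `1 - ε`. It rests on density of ridge functions for continuous non-polynomial `σ`
(`span_ridge_dense`). -/

/-! ### Universal approximation by ridge functions -/

theorem Submodule.integral_mem_of_isClosed {α E : Type*} [MeasurableSpace α] [NormedAddCommGroup E]
    [NormedSpace ℝ E] [CompleteSpace E] {μ : Measure α} {V : Submodule ℝ E}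
    (hV : IsClosed (V : Set E)) {f : α → E} (hf : ∀ x, f x ∈ V) :
    ∫ x, f x ∂μ ∈ V := by
  have : CompleteSpace V := hV.completeSpace_coe
  have h := V.subtypeₗᵢ.integral_comp_comm (fun x => (⟨f x, hf x⟩ : V)) (μ := μ)
  simp only [Submodule.coe_subtypeₗᵢ, Submodule.subtype_apply] at h
  rw [h]
  exact Submodule.coe_mem _

theorem exists_coeff_of_iteratedDeriv_eq_zero {g : ℝ → ℝ} {n : ℕ} (hg : ContDiff ℝ n g)
    (h : ∀ x, iteratedDeriv n g x = 0) :
    ∃ c : ℕ → ℝ, ∀ x, g x = ∑ i ∈ Finset.range n, c i * x ^ i := by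
  induction n generalizing g with
  | zero => exact ⟨0, fun x => by simpa using h x⟩
  | succ n ih =>
    have hd : ContDiff ℝ n (deriv g) := by
      exact ((contDiff_succ_iff_deriv (n := n)).1 (by exact_mod_cast hg)).2.2
    obtain ⟨c, hc⟩ := ih hd fun x => by rw [← iteratedDeriv_succ']; exact h x
    refine ⟨fun i => if i = 0 then g 0 else c (i - 1) / i, fun x => ?_⟩
    have hgd : ∀ x, HasDerivAt (fun y => g y - ∑ i ∈ Finset.range n, c i / ((i + 1 : ℕ) : ℝ) * y ^ (i + 1))
        (deriv g x - ∑ i ∈ Finset.range n, c i / ((i + 1 : ℕ) : ℝ) * (((i + 1 : ℕ) : ℝ) * x ^ i)) x := by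
      intro x
      refine HasDerivAt.sub ((hg.differentiable (by simp)) x).hasDerivAt ?_
      refine HasDerivAt.fun_sum fun i _ => ?_
      exact (hasDerivAt_pow (i + 1) x).const_mul _
    have hz : ∀ x, deriv (fun y => g y - ∑ i ∈ Finset.range n, c i / ((i + 1 : ℕ) : ℝ) * y ^ (i + 1)) x
        = 0 := by
      intro x
      rw [(hgd x).deriv, hc x, sub_eq_zero]
      refine Finset.sum_congr rfl fun i _ => ?_
      field_simp
    have := is_const_of_deriv_eq_zero (fun x => (hgd x).differentiableAt) hz x 0
    simp only [ne_eq, Nat.add_eq_zero_iff, one_ne_zero, and_false, not_false_eq_true, zero_pow,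
      mul_zero, Finset.sum_const_zero, sub_zero] at this
    rw [Finset.sum_range_succ']
    simp only [Nat.add_eq_zero_iff, one_ne_zero, and_false, if_false, Nat.add_sub_cancel, if_true,
      pow_zero, mul_one]
    linarith

theorem exists_polynomial_of_iteratedDeriv_eq_zero {g : ℝ → ℝ} {n : ℕ} (hg : ContDiff ℝ n g)
    (h : ∀ x, iteratedDeriv n g x = 0) :
    ∃ p : Polynomial ℝ, p.degree < n ∧ ∀ x, g x = p.eval x := by
  obtain ⟨c, hc⟩ := exists_coeff_of_iteratedDeriv_eq_zero hg h
  refine ⟨∑ i ∈ Finset.range n, Polynomial.C (c i) * Polynomial.X ^ i, ?_, fun x => ?_⟩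
  · rw [← Polynomial.mem_degreeLT]
    refine Submodule.sum_mem _ fun i hi => Polynomial.mem_degreeLT.2 ?_
    exact (Polynomial.degree_C_mul_X_pow_le i _).trans_lt (by exact_mod_cast Finset.mem_range.1 hi)
  · rw [hc, Polynomial.eval_finsetSum]
    simp

/-- Because the degrees are bounded uniformly, Lagrange interpolation at `n` fixed nodes writes each
value as a fixed linear combination of the node values, and this identity survives pointwise limits.
-/
theorem exists_polynomial_of_tendsto {n : ℕ} {p : ℕ → Polynomial ℝ}
    (hp : ∀ k, (p k).degree < n) {σ : ℝ → ℝ}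
    (h : ∀ x, Filter.Tendsto (fun k => (p k).eval x) Filter.atTop (nhds (σ x))) :
    ∃ q : Polynomial ℝ, ∀ x, σ x = q.eval x := by
  let v : ℕ → ℝ := fun i => i
  have hv : Set.InjOn v (Finset.range n) := fun i _ j _ hij => by simpa [v] using hij
  refine ⟨Lagrange.interpolate (Finset.range n) v fun i => σ (v i), fun x => ?_⟩
  have h1 : ∀ k, p k = Lagrange.interpolate (Finset.range n) v fun i => (p k).eval (v i) :=
    fun k => Lagrange.eq_interpolate hv (by simpa using hp k)
  refine tendsto_nhds_unique (h x) ?_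
  have h2 : ∀ k, (p k).eval x = ∑ i ∈ Finset.range n,
      (p k).eval (v i) * (Lagrange.basis (Finset.range n) v i).eval x := fun k => by
    conv_lhs => rw [h1 k]
    simp [Lagrange.interpolate_apply, Polynomial.eval_finsetSum]
  simp only [h2, Lagrange.interpolate_apply, Polynomial.eval_finsetSum, Polynomial.eval_mul,
    Polynomial.eval_C]
  exact tendsto_finsetSum _ fun i _ => (h (v i)).mul_const _

-- Otherwise all mollifications of `σ` would be polynomials of degree below the same `n`, and
-- shrinking the bumps would make `σ` itself a polynomial.
open scoped Convolution in
theorem exists_mollification_iteratedDeriv_ne_zero {σ : ℝ → ℝ} (hσ : Continuous σ)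
    (hσ' : ¬ ∃ p : Polynomial ℝ, ∀ s, σ s = p.eval s) (n : ℕ) :
    ∃ φ : ContDiffBump (0 : ℝ), ∃ b : ℝ,
      iteratedDeriv n (φ.normed volume ⋆[ContinuousLinearMap.lsmul ℝ ℝ, volume] σ) b ≠ 0 := by
  by_contra! hcon
  let φ : ℕ → ContDiffBump (0 : ℝ) := fun k =>
    ⟨1 / (2 * (k + 1)), 1 / (k + 1), by positivity, by
      apply one_div_lt_one_div_of_lt <;> [positivity; linarith [(k.cast_nonneg : (0:ℝ) ≤ k)]]⟩
  have hφ : Filter.Tendsto (fun k => (φ k).rOut) Filter.atTop (nhds 0) :=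
    tendsto_one_div_add_atTop_nhds_zero_nat
  have h1 : ∀ k, ∃ p : Polynomial ℝ, p.degree < n ∧
      ∀ x, ((φ k).normed volume ⋆[ContinuousLinearMap.lsmul ℝ ℝ, volume] σ) x = p.eval x :=
    fun k => exists_polynomial_of_iteratedDeriv_eq_zero
      ((φ k).hasCompactSupport_normed.contDiff_convolution_left _ (φ k).contDiff_normed
        hσ.locallyIntegrable) (hcon (φ k))
  choose p hp hpe using h1
  refine hσ' (exists_polynomial_of_tendsto hp fun x => ?_)
  simp only [← hpe]
  exact ContDiffBump.convolution_tendsto_right_of_continuous hφ hσ x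

section
variable {K : Type*} [TopologicalSpace K] [CompactSpace K]

-- The convolution is a Bochner integral in `C(K, ℝ)` of weighted translates of `σ` along `p`, all
-- of which lie in the closed subspace `V`.
open scoped Convolution in
theorem ContinuousMap.convolution_comp_mem {V : Submodule ℝ C(K, ℝ)}
    (hV : IsClosed (V : Set C(K, ℝ))) {σ : C(ℝ, ℝ)} {φ : ContDiffBump (0 : ℝ)} {p g : C(K, ℝ)}
    (hσ : ∀ b : ℝ, σ.comp (p + ContinuousMap.const K b) ∈ V)
    (hg : ∀ k, g k = (φ.normed volume ⋆[ContinuousLinearMap.lsmul ℝ ℝ, volume] σ) (p k)) :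
    g ∈ V := by
  let F : ℝ → C(K, ℝ) := fun t => φ.normed volume t • σ.comp (p + ContinuousMap.const K (-t))
  have hc : Continuous fun t : ℝ => σ.comp (p + ContinuousMap.const K (-t)) :=
    ContinuousMap.continuous_of_continuous_uncurry _ (by
      simp only [Function.uncurry_def, ContinuousMap.comp_apply, ContinuousMap.add_apply,
        ContinuousMap.const_apply]
      fun_prop)
  have hF : Integrable F := by
    refine Continuous.integrable_of_hasCompactSupport
      ((φ.contDiff_normed (n := 0)).continuous.smul hc) ?_
    exact φ.hasCompactSupport_normed.smul_right
  have : g = ∫ t, F t := by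
    ext k
    rw [hg, convolution_def, ContinuousMap.integral_apply hF]
    simp [F, sub_eq_add_neg]
  rw [this]
  exact Submodule.integral_mem_of_isClosed hV (fun t => V.smul_mem _ (hσ _))

/-- Subtract from `g (b + h p)` its Taylor terms of order below `n`, which lie in `V`, and divide by
`h ^ n`. As `h → 0` this tends to a nonzero multiple of `p ^ n`, uniformly on `K` since `p` is
bounded. -/
theorem ContinuousMap.pow_mem_of_taylor {V : Submodule ℝ C(K, ℝ)}
    (hV : IsClosed (V : Set C(K, ℝ))) {n : ℕ} {p : C(K, ℝ)} (hp : ∀ j < n, p ^ j ∈ V)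
    {g : C(ℝ, ℝ)} (hg : ContDiff ℝ n g) {b : ℝ}
    (hgV : ∀ h : ℝ, g.comp (h • p + ContinuousMap.const K b) ∈ V)
    (hb : iteratedDeriv n g b ≠ 0) : p ^ n ∈ V := by
  let c : ℕ → ℝ := fun k => iteratedDeriv k g b / k.factorial
  have hcn : c n ≠ 0 := div_ne_zero hb (by positivity)
  have ht : (fun y => g (b + y) - ∑ k ∈ Finset.range (n + 1), c k * y ^ k)
      =o[nhds 0] fun y => y ^ n := by
    have h1 := (taylor_isLittleO_univ (x₀ := b) hg).comp_tendsto
      (k := fun y : ℝ => b + y) (l' := nhds 0)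
      (by simpa using (continuous_const_add b).tendsto (0 : ℝ))
    simp only [Function.comp_def, add_sub_cancel_left] at h1
    refine h1.congr_left fun y => ?_
    simp only [taylor_within_apply, iteratedDerivWithin_univ, add_sub_cancel_left, smul_eq_mul, c]
    congr 1
    exact Finset.sum_congr rfl fun k _ => by ring
  suffices h : c n • p ^ n ∈ V by
    simpa [smul_smul, inv_mul_cancel₀ hcn] using V.smul_mem (c n)⁻¹ h
  rw [← SetLike.mem_coe, ← hV.closure_eq]
  refine Metric.mem_closure_iff.2 fun ε hε => ?_
  have hR : 0 < ‖p‖ + 1 := by positivity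
  obtain ⟨δ, hδ, hδ'⟩ := Metric.eventually_nhds_iff.1
    (ht.bound (show 0 < ε / (2 * (‖p‖ + 1) ^ n) by positivity))
  -- This size keeps `h * p k` within the Taylor radius `δ` for all `k` simultaneously.
  let h : ℝ := δ / (2 * (‖p‖ + 1))
  have hh : 0 < h := by positivity
  refine ⟨(h ^ n)⁻¹ • (g.comp (h • p + ContinuousMap.const K b)
    - ∑ k ∈ Finset.range n, (c k * h ^ k) • p ^ k), ?_, ?_⟩
  · exact V.smul_mem _ (V.sub_mem (hgV h) (V.sum_mem fun k hk =>
      V.smul_mem _ (hp k (Finset.mem_range.1 hk))))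
  · refine lt_of_le_of_lt ((ContinuousMap.dist_le (half_pos hε).le).2 fun k => ?_) (half_lt_self hε)
    have hpk : |p k| ≤ ‖p‖ + 1 := (p.norm_coe_le_norm k).trans (by linarith)
    have hk := hδ' (y := h * p k) (by
      rw [dist_zero_right, Real.norm_eq_abs, abs_mul, abs_of_pos hh]
      calc h * |p k| ≤ h * (‖p‖ + 1) := by gcongr
        _ = δ / 2 := by simp only [h]; field_simp
        _ < δ := half_lt_self hδ)
    rw [Finset.sum_range_succ, Real.norm_eq_abs, Real.norm_eq_abs, abs_pow, abs_mul,
      abs_of_pos hh] at hk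
    have e : dist ((c n • p ^ n) k) (((h ^ n)⁻¹ • (g.comp (h • p + ContinuousMap.const K b)
        - ∑ k ∈ Finset.range n, (c k * h ^ k) • p ^ k)) k) = (h ^ n)⁻¹ *
        |g (b + h * p k) - (∑ x ∈ Finset.range n, c x * (h * p k) ^ x + c n * (h * p k) ^ n)| := by
      rw [dist_comm, Real.dist_eq, ← abs_of_pos (show 0 < (h ^ n)⁻¹ by positivity), ← abs_mul,
        abs_of_pos (show 0 < (h ^ n)⁻¹ by positivity)]
      congr 1
      simp only [ContinuousMap.smul_apply, ContinuousMap.sub_apply, ContinuousMap.comp_apply,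
        ContinuousMap.add_apply, ContinuousMap.const_apply, ContinuousMap.sum_apply,
        ContinuousMap.pow_apply, smul_eq_mul, add_comm b]
      have : ∑ x ∈ Finset.range n, c x * h ^ x * p k ^ x = ∑ x ∈ Finset.range n, c x * (h * p k) ^ x :=
        Finset.sum_congr rfl fun x _ => by ring
      rw [this]
      field_simp
      ring
    rw [e]
    calc _ ≤ (h ^ n)⁻¹ * (ε / (2 * (‖p‖ + 1) ^ n) * (h * |p k|) ^ n) := by gcongr
      _ = ε / (2 * (‖p‖ + 1) ^ n) * |p k| ^ n := by
        rw [mul_pow]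
        field_simp
      _ ≤ ε / (2 * (‖p‖ + 1) ^ n) * (‖p‖ + 1) ^ n := by gcongr
      _ = ε / 2 := by field_simp

/-- A mollification of `σ` stands in for `σ` in the Taylor argument; it is smooth, and its
compositions stay in `V`. -/
theorem ContinuousMap.pow_mem_of_comp_mem {V : Submodule ℝ C(K, ℝ)}
    (hV : IsClosed (V : Set C(K, ℝ))) {σ : C(ℝ, ℝ)}
    (hσ' : ¬ ∃ p : Polynomial ℝ, ∀ s, σ s = p.eval s) {p : C(K, ℝ)}
    (hσ : ∀ h b : ℝ, σ.comp (h • p + ContinuousMap.const K b) ∈ V) (n : ℕ) : p ^ n ∈ V := by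
  induction n using Nat.strong_induction_on with
  | _ n ih =>
    obtain ⟨φ, b, hb⟩ := exists_mollification_iteratedDeriv_ne_zero σ.continuous hσ' n
    have hs := fun m : ℕ∞ => φ.hasCompactSupport_normed.contDiff_convolution_left
      (ContinuousLinearMap.lsmul ℝ ℝ) (φ.contDiff_normed (n := m) (μ := volume))
        (σ.continuous.locallyIntegrable (μ := volume))
    refine ContinuousMap.pow_mem_of_taylor hV ih (g := ⟨_, (hs 0).continuous⟩) (hs n) (b := b)
      (fun h => ?_) hb
    refine ContinuousMap.convolution_comp_mem hV (σ := σ) (φ := φ)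
      (p := h • p + ContinuousMap.const K b) (fun c => ?_) fun k => rfl
    convert hσ h (b + c) using 2
    ext k
    simp [add_assoc]

/-- The ridge function `k ↦ σ (a ⬝ u k + b)`. -/
def ridge (σ : C(ℝ, ℝ)) {I : Type*} [Fintype I] (u : C(K, I → ℝ)) (q : (I → ℝ) × ℝ) : C(K, ℝ) :=
  σ.comp ⟨fun k => (∑ j, q.1 j * u k j) + q.2, by fun_prop⟩

/-- Universal approximation: ridge functions of a continuous non-polynomial activation function
span a dense subspace. -/
theorem span_ridge_dense {σ : C(ℝ, ℝ)} (hσ' : ¬ ∃ p : Polynomial ℝ, ∀ s, σ s = p.eval s)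
    {I : Type*} [Fintype I] {u : C(K, I → ℝ)} (hu : Function.Injective u) :
    (Submodule.span ℝ (Set.range (ridge σ u))).topologicalClosure = ⊤ := by
  set V := (Submodule.span ℝ (Set.range (ridge σ u))).topologicalClosure
  have hV : IsClosed (V : Set C(K, ℝ)) := Submodule.isClosed_topologicalClosure _
  classical
  let lin : (I → ℝ) → C(K, ℝ) := fun a => ⟨fun k => ∑ j, a j * u k j, by fun_prop⟩
  -- Exponentials of linear forms are closed under products, so the algebra they generate is just
  -- their linear span. Stone–Weierstrass then applies although `V` is not known to be an algebra.
  let S : Submonoid C(K, ℝ) :=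
    { carrier := Set.range fun a => NormedSpace.exp (lin a)
      one_mem' := ⟨0, by
        have : lin 0 = 0 := by ext; simp [lin]
        simp [this]⟩
      mul_mem' := by
        rintro _ _ ⟨a, rfl⟩ ⟨b, rfl⟩
        refine ⟨a + b, ?_⟩
        have : lin (a + b) = lin a + lin b := by
          ext; simp [lin, add_mul, Finset.sum_add_distrib]
        simp only [this]
        exact NormedSpace.exp_add }
  have hpow : ∀ a i, lin a ^ i ∈ V := fun a i =>
    ContinuousMap.pow_mem_of_comp_mem hV hσ' (fun h b => Submodule.le_topologicalClosure _
      (Submodule.subset_span ⟨(h • a, b), by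
        ext k
        simp [ridge, lin, Finset.mul_sum, mul_assoc]⟩)) i
  have hexp : ∀ f ∈ S, f ∈ V := by
    rintro _ ⟨a, rfl⟩
    refine hV.mem_of_tendsto (NormedSpace.exp_series_hasSum_exp' (𝕂 := ℝ) (lin a))
      (Filter.Eventually.of_forall fun s => V.sum_mem fun i _ => V.smul_mem _ (hpow a i))
  have hsep : (Algebra.adjoin ℝ (S : Set C(K, ℝ))).SeparatesPoints := by
    intro x y hxy
    obtain ⟨j, hj⟩ := Function.ne_iff.1 (hu.ne hxy)
    refine ⟨_, ⟨_, Algebra.subset_adjoin ⟨Pi.single j 1, rfl⟩, rfl⟩, ?_⟩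
    have hev : ∀ z, (NormedSpace.exp (lin (Pi.single j 1))) z = Real.exp (u z j) := by
      intro z
      have h1 := (NormedSpace.exp_series_hasSum_exp' (𝕂 := ℝ) (lin (Pi.single j 1))).map
        (ContinuousMap.evalCLM ℝ z) (ContinuousMap.evalCLM ℝ z).continuous
      have h2 := NormedSpace.exp_series_hasSum_exp' (𝕂 := ℝ) (u z j)
      rw [← Real.exp_eq_exp_ℝ] at h2
      have e : (ContinuousMap.evalCLM ℝ z ∘ fun i : ℕ =>
          ((i.factorial : ℝ)⁻¹ • lin (Pi.single j 1) ^ i : C(K, ℝ))) =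
          fun i => (i.factorial : ℝ)⁻¹ • u z j ^ i := by
        funext i
        simp [lin, Pi.single_apply, ContinuousMap.evalCLM_apply]
      rw [e] at h1
      exact h1.unique h2
    simp only [hev]
    exact fun h => hj (Real.exp_injective h)
  have htop := ContinuousMap.subalgebra_topologicalClosure_eq_top_of_separatesPoints _ hsep
  rw [eq_top_iff]
  intro f _
  have hf : f ∈ (Algebra.adjoin ℝ (S : Set C(K, ℝ))).topologicalClosure := htop ▸ Algebra.mem_top
  refine closure_minimal ?_ hV hf
  intro g hg
  have hg' : g ∈ Subalgebra.toSubmodule (Algebra.adjoin ℝ (S : Set C(K, ℝ))) := hg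
  rw [Algebra.adjoin_eq_span, Submonoid.closure_eq] at hg'
  exact Submodule.span_le.2 hexp hg'
end

/-! ### One neuron with time-dependent weights -/

/-- Taking the union of the supports lets all outputs share the same inner neurons `q`; only the
outer coefficients depend on `j`. -/
theorem exists_common_combination {E Q : Type*} [NormedAddCommGroup E] [NormedSpace ℝ E] {g : Q → E}
    (hd : (Submodule.span ℝ (Set.range g)).topologicalClosure = ⊤) {J : Type*} [Fintype J]
    (G : J → E) {ε : ℝ} (hε : 0 < ε) :
    ∃ (N : ℕ) (q : Fin N → Q) (C : J → Fin N → ℝ), ∀ j, ‖∑ r, C j r • g (q r) - G j‖ < ε := by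
  classical
  have h1 : ∀ j, ∃ l : Q →₀ ℝ, ‖(l.sum fun q c => c • g q) - G j‖ < ε := by
    intro j
    have h : G j ∈ (Submodule.span ℝ (Set.range g)).topologicalClosure := hd ▸ Submodule.mem_top
    obtain ⟨y, hy, hyd⟩ := Metric.mem_closure_iff.1 h ε hε
    obtain ⟨l, rfl⟩ := Finsupp.mem_span_range_iff_exists_finsupp.1 hy
    exact ⟨l, by rwa [← dist_eq_norm, dist_comm]⟩
  choose l hl using h1
  let S : Finset Q := Finset.univ.biUnion fun j => (l j).support
  refine ⟨S.card, fun r => S.equivFin.symm r, fun j r => l j (S.equivFin.symm r), fun j => ?_⟩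
  have : ∑ r, l j (S.equivFin.symm r) • g (S.equivFin.symm r) = (l j).sum fun q c => c • g q := by
    rw [Equiv.sum_comp S.equivFin.symm (fun q : S => l j q • g q),
      Finset.sum_coe_sort S (fun q => l j q • g q)]
    refine (Finset.sum_subset (Finset.subset_biUnion_of_mem (fun j => (l j).support)
      (Finset.mem_univ j)) fun q _ hq => ?_).symm
    simp [Finsupp.notMem_support_iff.1 hq]
  rw [this]
  exact hl j

/-- Primitives of shallow networks approximate continuous curves. -/
theorem exists_primitive_network_near {σ : C(ℝ, ℝ)}
    (hσ' : ¬ ∃ p : Polynomial ℝ, ∀ s, σ s = p.eval s) {ι : Type*} [Fintype ι] {τ₁ τ₂ : ℝ}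
    {γ : ℝ → ι → ℝ} (hγ : Continuous γ) {ε : ℝ} (hε : 0 < ε) :
    ∃ (γ₀ : ι → ℝ) (N : ℕ) (A D : Fin N → ℝ) (C : ι → Fin N → ℝ),
      ∀ t ∈ Set.Icc τ₁ τ₂, ∀ i,
        |γ₀ i + (∫ s in τ₁..t, ∑ r, C i r * σ (A r * s + D r)) - γ t i| ≤ ε := by
  -- The network approximates a derivative, but `γ` is only continuous; a polynomial is interposed.
  have hp : ∀ i, ∃ p : Polynomial ℝ, ∀ t ∈ Set.Icc τ₁ τ₂, |p.eval t - γ t i| < ε / 2 := fun i =>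
    exists_polynomial_near_of_continuousOn τ₁ τ₂ (fun t => γ t i)
      ((continuous_apply i).comp hγ).continuousOn (ε / 2) (half_pos hε)
  choose p hp using hp
  let u : C(Set.Icc τ₁ τ₂, Unit → ℝ) := ⟨fun t _ => t, by fun_prop⟩
  have hu : Function.Injective u := fun s t h => Subtype.ext (congrFun h ())
  let G : ι → C(Set.Icc τ₁ τ₂, ℝ) := fun i => ⟨fun t => (p i).derivative.eval (t : ℝ), by fun_prop⟩
  obtain ⟨N, q, C, hC⟩ := exists_common_combination (span_ridge_dense hσ' hu) G
    (show 0 < ε / (2 * (|τ₂ - τ₁| + 1)) by positivity)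
  refine ⟨fun i => (p i).eval τ₁, N, fun r => (q r).1 (), fun r => (q r).2, C, fun t ht i => ?_⟩
  have hft : ∫ s in τ₁..t, (p i).derivative.eval s = (p i).eval t - (p i).eval τ₁ :=
    intervalIntegral.integral_eq_sub_of_hasDerivAt (fun s _ => (p i).hasDerivAt s)
      ((p i).derivative.continuous.intervalIntegrable _ _)
  have hcont : Continuous fun s : ℝ => ∑ r, C i r * σ ((q r).1 () * s + (q r).2) := by fun_prop
  have hb : |∫ s in τ₁..t, ((∑ r, C i r * σ ((q r).1 () * s + (q r).2)) - (p i).derivative.eval s)|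
      ≤ ε / (2 * (|τ₂ - τ₁| + 1)) * |t - τ₁| := by
    rw [← Real.norm_eq_abs]
    refine intervalIntegral.norm_integral_le_of_norm_le_const fun s hs => ?_
    rw [Set.uIoc_of_le ht.1] at hs
    have hs' : s ∈ Set.Icc τ₁ τ₂ := ⟨hs.1.le, hs.2.trans ht.2⟩
    have := ((∑ r, C i r • ridge σ u (q r) - G i).norm_coe_le_norm ⟨s, hs'⟩).trans (hC i).le
    simpa [ridge, u, G, ContinuousMap.sum_apply] using this
  rw [intervalIntegral.integral_sub (hcont.intervalIntegrable _ _)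
    ((p i).derivative.continuous.intervalIntegrable _ _), hft] at hb
  have hb' : ε / (2 * (|τ₂ - τ₁| + 1)) * |t - τ₁| ≤ ε / 2 := by
    have : |t - τ₁| ≤ |τ₂ - τ₁| + 1 := by
      rw [abs_of_nonneg (sub_nonneg.2 ht.1), abs_of_nonneg (sub_nonneg.2 (ht.1.trans ht.2))]
      linarith [ht.2]
    calc _ ≤ ε / (2 * (|τ₂ - τ₁| + 1)) * (|τ₂ - τ₁| + 1) := by gcongr
      _ = ε / 2 := by field_simp
  have h1 := abs_le.1 (hb.trans hb')
  have h2 := abs_lt.1 (hp i t ht)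
  rw [abs_le]
  constructor <;> linarith [h1.1, h1.2, h2.1, h2.2]

theorem continuous_ridge {K : Type*} [TopologicalSpace K] (σ : C(ℝ, ℝ)) {I : Type*} [Fintype I] (u : C(K, I → ℝ)) :
    Continuous (ridge σ u) :=
  ContinuousMap.continuous_of_continuous_uncurry _ (by
    simp only [Function.uncurry_def, ridge, ContinuousMap.comp_apply, ContinuousMap.coe_mk]
    fun_prop)

section
variable {K : Type*} [TopologicalSpace K] [CompactSpace K]

-- The weight `c` is a bump of integral one at `s`, narrow enough both for the continuity of `F` and
-- to fit inside the interval.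
open scoped Convolution in
theorem exists_weight_integral_near {E : Type*} [NormedAddCommGroup E] [NormedSpace ℝ E]
    [CompleteSpace E] {F : ℝ → E} (hF : Continuous F) {τ₁ τ₂ s : ℝ} (hs : s ∈ Set.Ioo τ₁ τ₂)
    {ε : ℝ} (hε : 0 < ε) :
    ∃ c : ℝ → ℝ, Continuous c ∧ ‖(∫ t in τ₁..τ₂, c t • F t) - F s‖ ≤ ε := by
  obtain ⟨δ, hδ, hFδ⟩ := Metric.continuous_iff.1 hF s ε hε
  let r := min δ (min (s - τ₁) (τ₂ - s))
  have hr : 0 < r := lt_min hδ (lt_min (sub_pos.2 hs.1) (sub_pos.2 hs.2))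
  let φ : ContDiffBump (0 : ℝ) := ⟨r / 2, r, half_pos hr, half_lt_self hr⟩
  have hφ : Continuous (φ.normed volume) := (φ.contDiff_normed (n := 0)).continuous
  refine ⟨fun t => φ.normed volume (s - t), by fun_prop, ?_⟩
  have hsupp : Function.support (fun t => φ.normed volume (s - t) • F t) ⊆ Set.Ioc τ₁ τ₂ := by
    intro t ht
    have h1 : s - t ∈ Function.support (φ.normed volume) := left_ne_zero_of_smul ht
    rw [φ.support_normed_eq, mem_ball_zero_iff, Real.norm_eq_abs] at h1
    have h2 : r ≤ s - τ₁ := (min_le_right _ _).trans (min_le_left _ _)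
    have h3 : r ≤ τ₂ - s := (min_le_right _ _).trans (min_le_right _ _)
    have h4 : |s - t| < r := h1
    rw [abs_lt] at h4
    constructor <;> linarith
  rw [intervalIntegral.integral_eq_integral_of_support_subset hsupp, ← dist_eq_norm]
  have h := φ.dist_normed_convolution_le (μ := volume) (g := F) (x₀ := s) (ε := ε)
    hF.aestronglyMeasurable fun x hx => (hFδ x ((Metric.mem_ball.1 hx).trans_le
      (min_le_left _ _))).le
  rwa [convolution_eq_swap] at h

/-- A sum over the neurons of a wide network becomes an integral over time: `p` interpolates the
inner parameters `q r` at distinct times `s r`, and `c` is a combination of approximate Dirac masses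
at these times with the outer coefficients. -/
theorem exists_curve_readout_near {σ : C(ℝ, ℝ)}
    (hσ' : ¬ ∃ p : Polynomial ℝ, ∀ s, σ s = p.eval s) {I : Type*} [Fintype I] {u : C(K, I → ℝ)}
    (hu : Function.Injective u) {J : Type*} [Fintype J] (G : J → C(K, ℝ)) {τ₁ τ₂ : ℝ}
    (hτ : τ₁ < τ₂) {ε : ℝ} (hε : 0 < ε) :
    ∃ (p : ℝ → (I → ℝ) × ℝ) (c : ℝ → J → ℝ), Continuous p ∧ Continuous c ∧
      ∀ j, ‖(∫ t in τ₁..τ₂, c t j • ridge σ u (p t)) - G j‖ ≤ ε := by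
  obtain ⟨N, q, C, hC⟩ := exists_common_combination (span_ridge_dense hσ' hu) G (half_pos hε)
  -- The shifts by one keep all nodes strictly inside the interval, where the bumps have room.
  let s : Fin N → ℝ := fun r => τ₁ + (τ₂ - τ₁) * ((r + 1) / (N + 1))
  have hτ' : 0 < τ₂ - τ₁ := sub_pos.2 hτ
  have hs : ∀ r, s r ∈ Set.Ioo τ₁ τ₂ := fun r => by
    have h0 : (0 : ℝ) < (r + 1) / (N + 1) := by positivity
    have h1 : ((r : ℝ) + 1) / (N + 1) < 1 := by
      rw [div_lt_one (by positivity)]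
      exact_mod_cast Nat.succ_lt_succ r.2
    constructor <;> simp only [s] <;> nlinarith
  have hinj : Set.InjOn s (Finset.univ : Finset (Fin N)) := fun a _ b _ hab => by
    have h1 := mul_left_cancel₀ hτ'.ne' (add_left_cancel hab)
    have h2 : ((a : ℝ) + 1) = b + 1 := by
      field_simp at h1
      exact h1
    exact Fin.ext (by exact_mod_cast add_right_cancel h2)
  let P : (Fin N → ℝ) → Polynomial ℝ := fun v => Lagrange.interpolate Finset.univ s v
  have hP : ∀ v r, (P v).eval (s r) = v r := fun v r =>
    Lagrange.eval_interpolate_at_node v hinj (Finset.mem_univ r)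
  let p : ℝ → (I → ℝ) × ℝ := fun t =>
    (fun i => (P fun r => (q r).1 i).eval t, (P fun r => (q r).2).eval t)
  have hp : Continuous p := by fun_prop
  have hps : ∀ r, p (s r) = q r := fun r => Prod.ext (funext fun i => hP _ r) (hP _ r)
  -- The double sum bounds the total outer weight of every output, so one bump accuracy serves all
  -- `j`.
  let M : ℝ := ∑ j, ∑ r, |C j r|
  have hM : 0 ≤ M := Finset.sum_nonneg fun j _ => Finset.sum_nonneg fun r _ => abs_nonneg _
  have hF : Continuous fun t => ridge σ u (p t) := (continuous_ridge σ u).comp hp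
  choose c hc hcF using fun r => exists_weight_integral_near hF (hs r)
    (show 0 < ε / (2 * (M + 1)) by positivity)
  refine ⟨p, fun t j => ∑ r, C j r * c r t, hp, by fun_prop, fun j => ?_⟩
  have hint : ∫ t in τ₁..τ₂, (∑ r, C j r * c r t) • ridge σ u (p t) =
      ∑ r, C j r • ∫ t in τ₁..τ₂, c r t • ridge σ u (p t) := by
    simp_rw [Finset.sum_smul, mul_smul]
    have hi : ∀ r, Continuous fun t => C j r • c r t • ridge σ u (p t) := fun r =>
      ((hc r).smul hF).const_smul (C j r)
    rw [intervalIntegral.integral_finsetSum fun r _ => (hi r).intervalIntegrable _ _]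
    simp_rw [intervalIntegral.integral_smul]
  have h1 : ‖(∫ t in τ₁..τ₂, (∑ r, C j r * c r t) • ridge σ u (p t)) -
      ∑ r, C j r • ridge σ u (q r)‖ ≤ ε / 2 := by
    rw [hint, ← Finset.sum_sub_distrib]
    calc _ ≤ ∑ r, |C j r| * (ε / (2 * (M + 1))) := norm_sum_le_of_le _ fun r _ => by
            rw [← smul_sub, norm_smul, Real.norm_eq_abs, ← hps r]
            exact mul_le_mul_of_nonneg_left (hcF r) (abs_nonneg _)
      _ = (∑ r, |C j r|) * (ε / (2 * (M + 1))) := by rw [Finset.sum_mul]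
      _ ≤ (M + 1) * (ε / (2 * (M + 1))) := by
        gcongr
        exact (Finset.single_le_sum (f := fun j => ∑ r, |C j r|)
          (fun j _ => Finset.sum_nonneg fun r _ => abs_nonneg _) (Finset.mem_univ j)).trans
          (le_add_of_nonneg_right zero_le_one)
      _ = ε / 2 := by field_simp
  calc _ ≤ _ := norm_sub_le_norm_sub_add_norm_sub _ (∑ r, C j r • ridge σ u (q r)) _
    _ ≤ ε / 2 + ε / 2 := add_le_add h1 (hC j).le
    _ = ε := add_halves ε

/-- `Φ` is uniformly continuous near the compact image of `γ`, so the integral is stable under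
uniform perturbations of the curve. -/
theorem exists_delta_integral_near {E F : Type*} [NormedAddCommGroup E] [NormedAddCommGroup F]
    [NormedSpace ℝ F] {Φ : E → F} (hΦ : Continuous Φ) {γ : ℝ → E} (hγ : Continuous γ)
    {τ₁ τ₂ : ℝ} (hτ : τ₁ ≤ τ₂) {ε : ℝ} (hε : 0 < ε) :
    ∃ δ > 0, ∀ γ' : ℝ → E, Continuous γ' → (∀ t ∈ Set.Icc τ₁ τ₂, ‖γ' t - γ t‖ ≤ δ) →
      ‖(∫ t in τ₁..τ₂, Φ (γ' t)) - ∫ t in τ₁..τ₂, Φ (γ t)‖ ≤ ε := by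
  have hε' : 0 < ε / (|τ₂ - τ₁| + 1) := by positivity
  have hK : IsCompact (γ '' Set.Icc τ₁ τ₂) := isCompact_Icc.image hγ
  obtain ⟨δ, hδ, h⟩ := Metric.mem_uniformity_dist.1
    (hK.uniformContinuousAt_of_continuousAt Φ (fun _ _ => hΦ.continuousAt)
      (Metric.dist_mem_uniformity hε'))
  refine ⟨δ / 2, half_pos hδ, fun γ' hγ' hd => ?_⟩
  have h₁ : Continuous fun t => Φ (γ' t) := hΦ.comp hγ'
  have h₂ : Continuous fun t => Φ (γ t) := hΦ.comp hγ
  rw [← intervalIntegral.integral_sub (h₁.intervalIntegrable _ _) (h₂.intervalIntegrable _ _)]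
  calc _ ≤ ε / (|τ₂ - τ₁| + 1) * |τ₂ - τ₁| := by
        refine intervalIntegral.norm_integral_le_of_norm_le_const fun t ht => ?_
        rw [Set.uIoc_of_le hτ] at ht
        have ht' : t ∈ Set.Icc τ₁ τ₂ := ⟨ht.1.le, ht.2⟩
        have h1 : dist (γ t) (γ' t) < δ := by
          rw [dist_comm, dist_eq_norm]
          exact (hd t ht').trans_lt (half_lt_self hδ)
        have h2 : dist (Φ (γ t)) (Φ (γ' t)) < ε / (|τ₂ - τ₁| + 1) := h h1 ⟨t, ht', rfl⟩
        rw [← dist_eq_norm, dist_comm]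
        exact h2.le
    _ ≤ ε / (|τ₂ - τ₁| + 1) * (|τ₂ - τ₁| + 1) := by gcongr; linarith
    _ = ε := by field_simp

/-- The ideal weight curve is replaced by one that a drift network in `t` can generate. Accuracy
costs only the width `N` of that network; the number of weight coordinates stays fixed. -/
theorem exists_network_weights_readout_near {σ : C(ℝ, ℝ)}
    (hσ' : ¬ ∃ p : Polynomial ℝ, ∀ s, σ s = p.eval s) {I : Type*} [Fintype I] {u : C(K, I → ℝ)}
    (hu : Function.Injective u) {J : Type*} [Fintype J] (G : J → C(K, ℝ)) {τ₁ τ₂ : ℝ}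
    (hτ : τ₁ < τ₂) {ε : ℝ} (hε : 0 < ε) :
    ∃ (γ₀ : I ⊕ Unit ⊕ J → ℝ) (N : ℕ) (A D : Fin N → ℝ) (C : I ⊕ Unit ⊕ J → Fin N → ℝ)
      (w : ℝ → I ⊕ Unit ⊕ J → ℝ), Continuous w ∧
      (∀ t i, w t i = γ₀ i + ∫ s in τ₁..t, ∑ r, C i r * σ (A r * s + D r)) ∧
      ∀ k j, |(∫ t in τ₁..τ₂, w t (.inr (.inr j)) *
        σ ((∑ i, w t (.inl i) * u k i) + w t (.inr (.inl ())))) - G j k| ≤ ε := by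
  obtain ⟨p, c, hp, hc, hpc⟩ := exists_curve_readout_near hσ' hu G hτ (half_pos hε)
  let γ : ℝ → I ⊕ Unit ⊕ J → ℝ := fun t => Sum.elim (p t).1 (Sum.elim (fun _ => (p t).2) (c t))
  have hγ : Continuous γ := continuous_pi fun i => by
    rcases i with i | i | i <;> simp only [γ, Sum.elim_inl, Sum.elim_inr] <;> fun_prop
  let Φ : J → (I ⊕ Unit ⊕ J → ℝ) → C(K, ℝ) := fun j v =>
    v (.inr (.inr j)) • ridge σ u (fun i => v (.inl i), v (.inr (.inl ())))
  have hΦ : ∀ j, Continuous (Φ j) := fun j =>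
    (continuous_apply _).smul ((continuous_ridge σ u).comp (by fun_prop))
  choose δ hδ hδ' using fun j => exists_delta_integral_near (hΦ j) hγ hτ.le (half_pos hε)
  obtain ⟨δ₀, hδ₀, hle⟩ : ∃ δ₀ > 0, ∀ j, δ₀ ≤ δ j := by
    rcases isEmpty_or_nonempty J with _ | _
    · exact ⟨1, one_pos, fun j => isEmptyElim j⟩
    · exact ⟨Finset.univ.inf' Finset.univ_nonempty δ, by simpa using hδ, fun j =>
        Finset.inf'_le _ (Finset.mem_univ j)⟩
  obtain ⟨γ₀, N, A, D, C, h⟩ := exists_primitive_network_near hσ' (τ₁ := τ₁) (τ₂ := τ₂) hγ hδ₀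
  let w : ℝ → I ⊕ Unit ⊕ J → ℝ := fun t i =>
    γ₀ i + ∫ s in τ₁..t, ∑ r, C i r * σ (A r * s + D r)
  have hw : Continuous w := continuous_pi fun i => continuous_const.add
    (intervalIntegral.continuous_primitive
      (fun a b => Continuous.intervalIntegrable (by fun_prop) a b) τ₁)
  refine ⟨γ₀, N, A, D, C, w, hw, fun _ _ => rfl, fun k j => ?_⟩
  have h1 := hδ' j w hw fun t ht => (pi_norm_le_iff_of_nonneg (hδ j).le).2 fun i =>
    (h t ht i).trans (hle j)
  have h2 : ‖(∫ t in τ₁..τ₂, Φ j (w t)) - G j‖ ≤ ε := by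
    calc _ ≤ _ := norm_sub_le_norm_sub_add_norm_sub _ (∫ t in τ₁..τ₂, Φ j (γ t)) _
      _ ≤ ε / 2 + ε / 2 := add_le_add h1 (hpc j)
      _ = ε := add_halves ε
  have h3 := (((∫ t in τ₁..τ₂, Φ j (w t)) - G j).norm_coe_le_norm k).trans h2
  have h4 : (∫ t in τ₁..τ₂, Φ j (w t)) k = ∫ t in τ₁..τ₂, Φ j (w t) k :=
    ((ContinuousMap.evalCLM ℝ k).intervalIntegral_comp_comm
      (((hΦ j).comp hw).intervalIntegrable _ _)).symm
  rw [ContinuousMap.sub_apply, h4] at h3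
  exact h3
end

/-! ### Gaussian noise from integrated Brownian motion -/

theorem tendsto_riemann_sum {g : ℝ → ℝ} (hg : Continuous g) {T : ℝ} (hT : 0 ≤ T) :
    Filter.Tendsto (fun n : ℕ => T / n * ∑ k ∈ Finset.range n, g (T * (k + 1) / n))
      Filter.atTop (nhds (∫ s in (0 : ℝ)..T, g s)) := by
  rw [Metric.tendsto_atTop]
  intro ε hε
  have hε' : 0 < ε / (2 * (T + 1)) := by positivity
  obtain ⟨δ, hδ, h⟩ := Metric.mem_uniformity_dist.1
    ((isCompact_Icc (a := (0 : ℝ)) (b := T)).uniformContinuousAt_of_continuousAt g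
      (fun _ _ => hg.continuousAt) (Metric.dist_mem_uniformity hε'))
  obtain ⟨N, hN⟩ := exists_nat_gt (T / δ)
  refine ⟨N + 1, fun n hn => ?_⟩
  have hn0 : 0 < n := by omega
  have hn' : (0 : ℝ) < n := by exact_mod_cast hn0
  have hTn : T / n < δ := by
    rw [div_lt_iff₀ hn', mul_comm, ← div_lt_iff₀ hδ]
    exact hN.trans (by exact_mod_cast hn)
  let a : ℕ → ℝ := fun k => T * k / n
  have ha0 : a 0 = 0 := by simp [a]
  have han : a n = T := by simp only [a]; field_simp
  have hstep : ∀ k, a (k + 1) = a k + T / n := fun k => by simp only [a]; push_cast; ring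
  have hTn0 : 0 ≤ T / n := by positivity
  have hsum : ∑ k ∈ Finset.range n, ∫ s in a k..a (k + 1), g s = ∫ s in (0 : ℝ)..T, g s := by
    rw [intervalIntegral.sum_integral_adjacent_intervals fun k _ => hg.intervalIntegrable _ _,
      ha0, han]
  rw [← hsum, Finset.mul_sum, dist_eq_norm, ← Finset.sum_sub_distrib]
  calc _ ≤ ∑ k ∈ Finset.range n, ε / (2 * (T + 1)) * (T / n) := by
        refine norm_sum_le_of_le _ fun k hk => ?_
        have hk' : k + 1 ≤ n := Finset.mem_range.1 hk
        have e : T / n * g (T * (k + 1) / n) = ∫ _ in a k..a (k + 1), g (T * (k + 1) / n) := by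
          rw [intervalIntegral.integral_const, hstep, add_sub_cancel_left, smul_eq_mul]
        rw [e, ← intervalIntegral.integral_sub (by simp) (hg.intervalIntegrable _ _)]
        have := intervalIntegral.norm_integral_le_of_norm_le_const (a := a k) (b := a (k + 1))
          (f := fun s => g (T * (k + 1) / n) - g s) (C := ε / (2 * (T + 1))) fun s hs => ?_
        · rwa [hstep, add_sub_cancel_left, abs_of_nonneg hTn0, ← hstep] at this
        · rw [Set.uIoc_of_le (by rw [hstep]; linarith)] at hs
          have hend : T * (k + 1) / n = a (k + 1) := by simp [a]
          have hle : a (k + 1) ≤ T := by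
            rw [← han]
            simp only [a]
            gcongr
          have h0 : 0 ≤ a (k + 1) := by positivity
          have h2 : (g (a (k + 1)), g s) ∈ {p : ℝ × ℝ | dist p.1 p.2 < ε / (2 * (T + 1))} :=
            h (a := a (k + 1)) (b := s) (by
              rw [Real.dist_eq, abs_lt]
              have := hs.1
              have := hs.2
              rw [hstep] at *
              constructor <;> linarith) ⟨h0, hle⟩
          rw [hend, ← dist_eq_norm]
          exact le_of_lt h2
    _ = ε / (2 * (T + 1)) * T := by
      rw [Finset.sum_const, Finset.card_range, nsmul_eq_mul]
      field_simp
    _ ≤ ε / (2 * (T + 1)) * (T + 1) := by gcongr; linarith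
    _ = ε / 2 := by field_simp
    _ < ε := half_lt_self hε

/-- Brownian covariances at equidistant times are proportional to these minima, so this sum gives
the variance of a Riemann sum. -/
theorem sum_sum_min_succ (n : ℕ) :
    ∑ i ∈ Finset.range n, ∑ j ∈ Finset.range n, (min (i + 1) (j + 1) : ℝ) =
      n * (n + 1) * (2 * n + 1) / 6 := by
  induction n with
  | zero => simp
  | succ n ih =>
    have h1 : ∀ i ∈ Finset.range n, (min (i + 1) (n + 1) : ℝ) = i + 1 := fun i hi => by
      have : (i : ℝ) ≤ n := by exact_mod_cast (Finset.mem_range.1 hi).le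
      exact min_eq_left (by linarith)
    have h2 : ∑ i ∈ Finset.range n, ((i : ℝ) + 1) = n * (n + 1) / 2 := by
      clear ih h1
      induction n with
      | zero => simp
      | succ n ih => rw [Finset.sum_range_succ, ih]; push_cast; ring
    have h3 : ∑ j ∈ Finset.range n, (min (n + 1) (j + 1) : ℝ) = n * (n + 1) / 2 := by
      rw [← h2]
      exact Finset.sum_congr rfl fun i hi => by rw [min_comm, h1 i hi]
    rw [Finset.sum_range_succ, Finset.sum_range_succ (fun j : ℕ => (min ((n : ℝ) + 1) (j + 1) : ℝ)),
      h3, min_self]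
    simp_rw [Finset.sum_range_succ (fun j : ℕ => (min (_ : ℝ) ((j : ℝ) + 1) : ℝ))]
    rw [Finset.sum_add_distrib, ih, Finset.sum_congr rfl h1, h2]
    push_cast
    ring

section
variable {Ω : Type*} [MeasurableSpace Ω] {P : Measure Ω}

/-- The Riemann sums of the path of a Brownian motion are Gaussian. -/
theorem ProbabilityTheory.IsPreBrownianReal.map_riemann_sum [IsProbabilityMeasure P]
    {W : ℝ≥0 → Ω → ℝ} (hW : IsPreBrownianReal W P) {T : ℝ} (hT : 0 ≤ T) (n : ℕ) :
    P.map (fun ω => T / n * ∑ k ∈ Finset.range n, W (T * (k + 1) / n).toNNReal ω) =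
      gaussianReal 0
        ((T / n) ^ 2 * (T / n * (n * (n + 1) * (2 * n + 1) / 6))).toNNReal := by
  let f : ℕ → ℝ≥0 := fun k => (T * (k + 1) / n).toNNReal
  have hG := (hW.isGaussianProcess.comp_right f)
  have h1 : HasGaussianLaw (fun ω => T / n * ∑ k ∈ Finset.range n, W (f k) ω) P :=
    (hG.hasGaussianLaw_fun_sum (I := Finset.range n)).fun_smul (T / n)
  change P.map (fun ω => T / n * ∑ k ∈ Finset.range n, W (f k) ω) = _
  rw [h1.map_eq_gaussianReal]
  have hm : ∫ ω, T / n * ∑ k ∈ Finset.range n, W (f k) ω ∂P = 0 := by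
    rw [integral_const_mul, integral_finsetSum _ fun k _ => hW.integrable_eval (f k)]
    simp [hW.integral_eval]
  have hv : Var[fun ω => T / n * ∑ k ∈ Finset.range n, W (f k) ω; P] =
      (T / n) ^ 2 * (T / n * (n * (n + 1) * (2 * n + 1) / 6)) := by
    rw [variance_const_mul, variance_fun_sum' fun k _ =>
      (hW.isGaussianProcess.hasGaussianLaw_eval (f k)).memLp_two]
    congr 1
    rw [← sum_sum_min_succ, Finset.mul_sum]
    refine Finset.sum_congr rfl fun i _ => ?_
    rw [Finset.mul_sum]
    refine Finset.sum_congr rfl fun j _ => ?_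
    rw [hW.covariance_eval, NNReal.coe_min, mul_min_of_nonneg _ _ (by positivity)]
    simp only [f]
    rw [Real.coe_toNNReal _ (by positivity), Real.coe_toNNReal _ (by positivity)]
    congr 1 <;> ring
  rw [hm, hv]

/-- An almost sure limit of centred Gaussian variables is Gaussian. -/
theorem map_eq_gaussianReal_of_tendsto [IsProbabilityMeasure P] {S : ℕ → Ω → ℝ} {I : Ω → ℝ}
    (hS : ∀ n, AEMeasurable (S n) P) (hI : AEMeasurable I P) {v : ℕ → ℝ≥0} {v₀ : ℝ≥0}
    (hv : Filter.Tendsto v Filter.atTop (nhds v₀))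
    (hlaw : ∀ n, P.map (S n) = gaussianReal 0 (v n))
    (hlim : ∀ᵐ ω ∂P, Filter.Tendsto (fun n => S n ω) Filter.atTop (nhds (I ω))) :
    P.map I = gaussianReal 0 v₀ := by
  have := Measure.isProbabilityMeasure_map (μ := P) hI
  -- The characteristic functions converge to both sides: by dominated convergence, and by
  -- continuity of the Gaussian one in the variance.
  refine Measure.ext_of_charFun (funext fun u => ?_)
  have hint : ∀ {Z : Ω → ℝ}, AEMeasurable Z P →
      charFun (P.map Z) u = ∫ ω, Complex.exp (u * Z ω * Complex.I) ∂P := fun hZ => by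
    rw [charFun_apply_real, integral_map hZ (by fun_prop)]
  have h1 : Filter.Tendsto (fun n => charFun (P.map (S n)) u) Filter.atTop
      (nhds (charFun (P.map I) u)) := by
    rw [hint hI]
    simp_rw [hint (hS _)]
    refine tendsto_integral_of_dominated_convergence (fun _ => 1) (fun n => ?_)
      (integrable_const _) (fun n => ?_) ?_
    · have := hS n
      exact AEMeasurable.aestronglyMeasurable (by fun_prop)
    · refine Filter.Eventually.of_forall fun ω => ?_
      rw [← Complex.ofReal_mul, Complex.norm_exp_ofReal_mul_I]
    · filter_upwards [hlim] with ω hω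
      have hc : Continuous fun z : ℝ => Complex.exp (u * z * Complex.I) := by fun_prop
      exact (hc.tendsto _).comp hω
  have h2 : Filter.Tendsto (fun n => charFun (gaussianReal 0 (v n)) u) Filter.atTop
      (nhds (charFun (gaussianReal 0 v₀) u)) := by
    simp only [charFun_gaussianReal]
    have hc : Continuous fun z : ℝ≥0 => Complex.exp (u * (0 : ℝ) * Complex.I - z * u ^ 2 / 2) := by
      fun_prop
    exact (hc.tendsto _).comp hv
  simp only [hlaw] at h1
  exact tendsto_nhds_unique h1 h2

theorem tendsto_riemann_variance {T : ℝ} :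
    Filter.Tendsto (fun n : ℕ => ((T / n) ^ 2 * (T / n * (n * (n + 1) * (2 * n + 1) / 6))).toNNReal)
      Filter.atTop (nhds (T ^ 3 / 3).toNNReal) := by
  refine (continuous_real_toNNReal.tendsto _).comp ?_
  have h : Filter.Tendsto (fun n : ℕ => T ^ 3 * (1 + (n : ℝ)⁻¹) * (2 + (n : ℝ)⁻¹) / 6)
      Filter.atTop (nhds (T ^ 3 * (1 + 0) * (2 + 0) / 6)) :=
    (((tendsto_inv_atTop_nhds_zero_nat.const_add 1).const_mul _).mul
      (tendsto_inv_atTop_nhds_zero_nat.const_add 2)).div_const 6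
  have e : T ^ 3 * (1 + 0) * (2 + 0) / 6 = T ^ 3 / 3 := by ring
  rw [e] at h
  refine h.congr' ?_
  filter_upwards [Filter.eventually_gt_atTop 0] with n hn
  have : (n : ℝ) ≠ 0 := by exact_mod_cast hn.ne'
  field_simp

/-- The integral of the increment `p s - p t` over `s ∈ [t, t + T]`, as a measurable functional of
the path `p`. -/
noncomputable def incrementIntegral (t T : ℝ) (p : ℝ≥0 → ℝ) : ℝ :=
  Filter.limsup (fun n : ℕ => T / n * ∑ k ∈ Finset.range n,
    (p (t.toNNReal + (T * (k + 1) / n).toNNReal) - p t.toNNReal)) Filter.atTop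

/-- Each Riemann sum reads finitely many times, so the `limsup` is measurable for the product
σ-algebra on all paths, continuous or not. This lets laws and independence pass from `B` to the
noise. -/
theorem measurable_incrementIntegral (t T : ℝ) : Measurable (incrementIntegral t T) :=
  Measurable.limsup fun n => by fun_prop

theorem tendsto_incrementIntegral {t T : ℝ} (ht : 0 ≤ t) (hT : 0 ≤ T) {p : ℝ≥0 → ℝ}
    (hp : Continuous p) :
    Filter.Tendsto (fun n : ℕ => T / n * ∑ k ∈ Finset.range n,
      (p (t.toNNReal + (T * (k + 1) / n).toNNReal) - p t.toNNReal)) Filter.atTop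
      (nhds (∫ s in t..t + T, (p s.toNNReal - p t.toNNReal))) := by
  have h := tendsto_riemann_sum
    (g := fun s => p (t.toNNReal + s.toNNReal) - p t.toNNReal) (by fun_prop) hT
  have e : ∫ s in (0 : ℝ)..T, (p (t.toNNReal + s.toNNReal) - p t.toNNReal) =
      ∫ s in t..t + T, (p s.toNNReal - p t.toNNReal) := by
    have h2 := intervalIntegral.integral_comp_add_left (a := 0) (b := T)
      (fun s => p s.toNNReal - p t.toNNReal) t
    rw [add_zero] at h2
    rw [← h2]
    refine intervalIntegral.integral_congr fun s hs => ?_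
    rw [Set.uIcc_of_le hT] at hs
    simp only [Real.toNNReal_add ht hs.1]
  rwa [e] at h

theorem incrementIntegral_eq {t T : ℝ} (ht : 0 ≤ t) (hT : 0 ≤ T) {p : ℝ≥0 → ℝ}
    (hp : Continuous p) :
    incrementIntegral t T p = ∫ s in t..t + T, (p s.toNNReal - p t.toNNReal) :=
  (tendsto_incrementIntegral ht hT hp).limsup_eq

theorem ProbabilityTheory.IsBrownianReal.map_incrementIntegral [IsProbabilityMeasure P]
    {B : ℝ≥0 → Ω → ℝ} (hB : IsBrownianReal B P) (hm : ∀ t, Measurable (B t)) {t T : ℝ}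
    (ht : 0 ≤ t) (hT : 0 ≤ T) :
    P.map (fun ω => incrementIntegral t T (B · ω)) = gaussianReal 0 (T ^ 3 / 3).toNNReal := by
  refine map_eq_gaussianReal_of_tendsto (fun n => ?_)
    ((measurable_incrementIntegral t T).comp (measurable_pi_lambda _ hm)).aemeasurable
    tendsto_riemann_variance
    (fun n => (hB.shift t.toNNReal).toIsPreBrownianReal.map_riemann_sum hT n) ?_
  · exact Measurable.aemeasurable (by fun_prop)
  · filter_upwards [hB.cont] with ω hω
    rw [Function.comp_apply, incrementIntegral_eq ht hT hω]
    exact tendsto_incrementIntegral ht hT hω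
end

section
variable {Ω : Type*} [MeasurableSpace Ω] {P : Measure Ω} [IsProbabilityMeasure P]

/-- The normalized integrals of the increments of some coordinates of a path. -/
noncomputable def pathNoise {m d : ℕ} (e : Fin m → Fin d) (t T : ℝ) (b : ℝ≥0 → Euc d) : Euc m :=
  WithLp.toLp 2 fun i => (√(T ^ 3 / 3))⁻¹ * incrementIntegral t T fun s => b s (e i)

theorem measurable_pathNoise {m d : ℕ} (e : Fin m → Fin d) (t T : ℝ) :
    Measurable (pathNoise e t T) := by
  refine (WithLp.measurable_toLp 2 _).comp (measurable_pi_lambda _ fun i => ?_)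
  refine ((measurable_incrementIntegral t T).comp (measurable_pi_lambda _ fun s => ?_)).const_mul _
  fun_prop

/-- Injectivity of `e` selects distinct, hence independent, coordinates of `B`; the prefactor
normalizes the variance `T ^ 3 / 3`. -/
theorem IsBrownianMotion.map_pathNoise {m d : ℕ} {e : Fin m → Fin d} (he : Function.Injective e)
    {t T : ℝ} (ht : 0 ≤ t) (hT : 0 < T) {B : ℝ≥0 → Ω → Euc d} (hB : IsBrownianMotion B P) :
    P.map (fun ω => pathNoise e t T (B · ω)) = stdGaussian (Euc m) := by
  have hm : ∀ i s, Measurable fun ω => B s ω (e i) := fun i s => by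
    have := hB.measurable s
    fun_prop
  let Z : Fin m → Ω → ℝ := fun i ω =>
    (√(T ^ 3 / 3))⁻¹ * incrementIntegral t T fun s => B s ω (e i)
  have hF := measurable_incrementIntegral t T
  have hZm : ∀ i, Measurable (Z i) := fun i =>
    (hF.comp (measurable_pi_lambda _ (hm i))).const_mul _
  have hZ : ∀ i, P.map (Z i) = gaussianReal 0 1 := fun i => by
    have h1 := (hB.brownian (e i)).map_incrementIntegral (hm i) ht hT.le
    have h2 := gaussianReal_map_const_mul (μ := 0) (v := (T ^ 3 / 3).toNNReal) (√(T ^ 3 / 3))⁻¹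
    have h3 : Measurable fun ω => incrementIntegral t T fun s => B s ω (e i) :=
      hF.comp (measurable_pi_lambda _ (hm i))
    rw [← h1, Measure.map_map (by fun_prop) h3] at h2
    refine h2.trans ?_
    congr 1
    · simp
    · ext
      have h4 : 0 < T ^ 3 / 3 := by positivity
      simp only [NNReal.coe_mul, NNReal.coe_mk, NNReal.coe_one, Real.coe_toNNReal _ h4.le, inv_pow,
        Real.sq_sqrt h4.le]
      exact inv_mul_cancel₀ h4.ne'
  have hind : iIndepFun Z P :=
    (hB.indep.precomp he).comp
      (fun _ p => (√(T ^ 3 / 3))⁻¹ * incrementIntegral t T p) fun _ => hF.const_mul _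
  have hmap := (iIndepFun_iff_map_fun_eq_pi_map fun i => (hZm i).aemeasurable).1 hind
  simp only [hZ] at hmap
  rw [← map_pi_eq_stdGaussian, ← hmap, Measure.map_map (WithLp.measurable_toLp 2 _)
    (measurable_pi_lambda _ hZm)]
  rfl
end

/-! ### The network and its drifts -/

open Classical in
/-- The partial equivalence which matches `f a` with `g a`. -/
noncomputable def PEquiv.ofEmbeddings {α β γ : Type*} (f : α ↪ β) (g : α ↪ γ) : β ≃. γ where
  toFun b := if h : ∃ a, f a = b then some (g h.choose) else none
  invFun c := if h : ∃ a, g a = c then some (f h.choose) else none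
  inv b c := by
    constructor
    · intro h
      split_ifs at h with hc
      obtain ⟨a, rfl⟩ := hc
      have h1 : ∃ a', g a' = g a := ⟨a, rfl⟩
      have h2 : f h1.choose = b := by simpa using h
      rw [g.injective h1.choose_spec] at h2
      subst h2
      simp
    · intro h
      split_ifs at h with hc
      obtain ⟨a, rfl⟩ := hc
      have h1 : ∃ a', f a' = f a := ⟨a, rfl⟩
      have h2 : g h1.choose = c := by simpa using h
      rw [f.injective h1.choose_spec] at h2
      subst h2
      simp

open Classical in
theorem PEquiv.ofEmbeddings_apply {α β γ : Type*} (f : α ↪ β) (g : α ↪ γ) (a : α) :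
    PEquiv.ofEmbeddings f g (f a) = some (g a) := by
  have h1 : ∃ a', f a' = f a := ⟨a, rfl⟩
  change (if h : ∃ a', f a' = f a then some (g h.choose) else none) = _
  rw [dif_pos h1, f.injective h1.choose_spec]

open Classical in
theorem PEquiv.ofEmbeddings_eq_none {α β γ : Type*} (f : α ↪ β) (g : α ↪ γ) {b : β}
    (hb : ∀ a, f a ≠ b) : PEquiv.ofEmbeddings f g b = none := by
  change (if h : ∃ a', f a' = b then some (g h.choose) else none) = _
  rw [dif_neg fun ⟨a, ha⟩ => hb a ha]

/-- The data of a network which accumulates noise up to time `τ₁` and computes a readout of input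
and noise by a single hidden neuron between `τ₁` and `τ₂`. -/
structure NoiseReadout (dx m dy dh dw : ℕ) where
  /-- positions of input, noise and output in the hidden state -/
  eh : (Fin dx ⊕ Fin m) ⊕ Fin dy ↪ Fin dh
  /-- positions of noise, inner weights, inner bias and outer weights in the weight vector -/
  ew : Fin m ⊕ ((Fin dx ⊕ Fin m) ⊕ Unit ⊕ Fin dy) ↪ Fin dw
  τ₁ : ℝ
  τ₂ : ℝ
  zero_lt_τ₁ : 0 < τ₁
  τ₁_lt_τ₂ : τ₁ < τ₂
  τ₂_lt_one : τ₂ < 1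
  γ₀ : (Fin dx ⊕ Fin m) ⊕ Unit ⊕ Fin dy → ℝ
  N : ℕ
  A : Fin N → ℝ
  D : Fin N → ℝ
  C : (Fin dx ⊕ Fin m) ⊕ Unit ⊕ Fin dy → Fin N → ℝ
  scale : ℝ

namespace NoiseReadout

variable {dx m dy dh dw : ℕ} (R : NoiseReadout dx m dy dh dw)

/-- The biases of the noise coordinates. -/
def noiseEmb : Fin m ↪ ParamIdx (1 + dh) [] dh where
  toFun i := Sum.inr (R.eh (.inl (.inr i)))
  inj' i j h := by simpa [ParamIdx] using h

/-- The connections of the single hidden neuron. -/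
def neuronEmb : (Fin dx ⊕ Fin m) ⊕ Unit ⊕ Fin dy ↪ ParamIdx (1 + dh) [1] dh where
  toFun
    | .inl i => Sum.inl (Sum.inl ((0 : Fin 1), Fin.natAdd 1 (R.eh (.inl i))))
    | .inr (.inl _) => Sum.inl (Sum.inr (0 : Fin 1))
    | .inr (.inr j) => Sum.inr (Sum.inl (R.eh (.inr j), (0 : Fin 1)))
  inj' := by
    rintro (i | i | i) (j | j | j) h <;> simp_all [ParamIdx]

/-- The parameters of the drift of the weights in the region `[τ₁, τ₂)`. -/
noncomputable def theta : ParamIdx (1 + dw) [R.N] dw → ℝ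
  -- Only the time input is connected, so the drift does not depend on `w`.
  | .inl (.inl (r, j)) => if j = Fin.castAdd dw (0 : Fin 1) then R.A r else 0
  | .inl (.inr r) => R.D r
  | .inr (.inl (k, r)) => Function.extend R.ew (Sum.elim 0 R.C) 0 k r
  | .inr (.inr _) => 0

/-- The network. -/
noncomputable def net : PSDEBNN dx dh dw where
  a := ∑ j : Fin dx, (LinearMap.proj (R := ℝ) (φ := fun _ : Fin dx => ℝ) j ∘ₗ
      (WithLp.linearEquiv 2 ℝ (Fin dx → ℝ)).toLinearMap).smulRight
        (EuclideanSpace.single (R.eh (.inl (.inl j))) (1 : ℝ))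
  w₀ := WithLp.toLp 2 (Function.extend R.ew (Sum.elim (fun _ => 0) R.γ₀) 0)
  τ₁ := R.τ₁
  τ₂ := R.τ₂
  zero_lt_τ₁ := R.zero_lt_τ₁
  τ₁_lt_τ₂ := R.τ₁_lt_τ₂
  τ₂_lt_one := R.τ₂_lt_one
  hiddenH
    | 0 => []
    | 1 => [1]
    | 2 => []
  -- First region: only biases at the noise positions, so these coordinates integrate the noise
  -- weights. Second region: one neuron reads input and noise and feeds only the output positions.
  -- Third region: no connection, so the hidden state is frozen.
  slot
    | 0 => PEquiv.ofEmbeddings R.noiseEmb (Function.Embedding.inl.trans R.ew)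
    | 1 => PEquiv.ofEmbeddings R.neuronEmb (Function.Embedding.inr.trans R.ew)
    | 2 => ⊥
  hiddenQ
    | 0 => []
    | 1 => [R.N]
    | 2 => []
  θ
    | 0 => fun _ => 0
    | 1 => R.theta
    | 2 => fun _ => 0
  -- Noise enters only its own block, so the neuron's weights stay deterministic although the
  -- diffusion acts on all of `(t₁, t₂)`.
  diffusion := Matrix.diagonal (Function.extend R.ew (Sum.elim (fun _ => R.scale) 0) 0)

theorem region_zero {t : ℝ} (ht : t < R.τ₁) : R.net.region t = 0 := if_pos ht

theorem region_one {t : ℝ} (ht : t ∈ Set.Ico R.τ₁ R.τ₂) : R.net.region t = 1 := by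
  rw [PSDEBNN.region, if_neg (show ¬ t < R.net.τ₁ from not_lt.2 ht.1)]
  exact if_pos ht.2

theorem region_two {t : ℝ} (ht : R.τ₂ ≤ t) : R.net.region t = 2 := by
  rw [PSDEBNN.region, if_neg (show ¬ t < R.net.τ₁ from not_lt.2 (R.τ₁_lt_τ₂.le.trans ht))]
  exact if_neg (not_lt.2 ht)

theorem net_a_inl_inl (x : Euc dx) (j : Fin dx) : R.net.a x (R.eh (.inl (.inl j))) = x j := by
  simp [net, LinearMap.sum_apply, Pi.single_apply]

theorem net_a_of_ne (x : Euc dx) {k : Fin dh} (hk : ∀ j, R.eh (.inl (.inl j)) ≠ k) :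
    R.net.a x k = 0 := by
  simp [net, LinearMap.sum_apply, fun j => (hk j).symm]

theorem net_w₀ (q) : R.net.w₀ (R.ew q) = Sum.elim (fun _ => 0) R.γ₀ q :=
  R.ew.injective.extend_apply _ _ q

variable (σ : ℝ → ℝ)

theorem net_fh_zero {t : ℝ} (ht : t < R.τ₁) (h : Euc dh) (w : Euc dw) (i : Fin m) :
    R.net.fh σ t h w (R.eh (.inl (.inr i))) = w (R.ew (.inl i)) := by
  rw [PSDEBNN.fh, R.region_zero ht]
  have h1 : ∀ j, R.net.slot 0 (Sum.inl (R.eh (.inl (.inr i)), j)) = none := fun j =>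
    PEquiv.ofEmbeddings_eq_none _ _ fun a => Sum.inr_ne_inl
  have h2 : R.net.slot 0 (Sum.inr (R.eh (.inl (.inr i)))) = some (R.ew (.inl i)) :=
    PEquiv.ofEmbeddings_apply R.noiseEmb (Function.Embedding.inl.trans R.ew) i
  change (∑ j, ((R.net.slot 0 (Sum.inl (R.eh (.inl (.inr i)), j))).elim 0 fun k => w k) * _) +
    ((R.net.slot 0 (Sum.inr (R.eh (.inl (.inr i))))).elim 0 fun k => w k) = _
  simp only [h1, h2]
  simp

theorem net_fh_zero_of_ne {t : ℝ} (ht : t < R.τ₁) (h : Euc dh) (w : Euc dw) {k : Fin dh}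
    (hk : ∀ i, R.eh (.inl (.inr i)) ≠ k) : R.net.fh σ t h w k = 0 := by
  rw [PSDEBNN.fh, R.region_zero ht]
  have h1 : ∀ j, R.net.slot 0 (Sum.inl (k, j)) = none := fun j =>
    PEquiv.ofEmbeddings_eq_none _ _ fun a => Sum.inr_ne_inl
  have h2 : R.net.slot 0 (Sum.inr k) = none :=
    PEquiv.ofEmbeddings_eq_none _ _ fun a h => hk a (Sum.inr_injective h)
  change (∑ j, ((R.net.slot 0 (Sum.inl (k, j))).elim 0 fun k => w k) * _) +
    ((R.net.slot 0 (Sum.inr k)).elim 0 fun k => w k) = _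
  simp only [h1, h2]
  simp

theorem net_fh_two {t : ℝ} (ht : R.τ₂ ≤ t) (h : Euc dh) (w : Euc dw) : R.net.fh σ t h w = 0 := by
  rw [PSDEBNN.fh, R.region_two ht]
  ext k
  change (∑ j, (0 : ℝ) * _) + (0 : ℝ) = 0
  simp

theorem slot_one_natAdd (i) : R.net.slot 1
    (Sum.inl (Sum.inl ((0 : Fin 1), Fin.natAdd 1 (R.eh (.inl i))))) = some (R.ew (.inr (.inl i))) :=
  PEquiv.ofEmbeddings_apply R.neuronEmb (Function.Embedding.inr.trans R.ew) (.inl i)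

theorem slot_one_eq_none {q : ParamIdx (1 + dh) [1] dh} (hq : ∀ a, R.neuronEmb a ≠ q) :
    R.net.slot 1 q = none :=
  PEquiv.ofEmbeddings_eq_none R.neuronEmb _ hq

theorem net_fh_one_eq {t : ℝ} (ht : t ∈ Set.Ico R.τ₁ R.τ₂) (h : Euc dh) (w : Euc dw)
    (k : Fin dh) :
    R.net.fh σ t h w k = (R.net.slot 1 (Sum.inr (Sum.inl (k, (0 : Fin 1))))).elim 0 (fun k => w k) *
      σ ((∑ i, w (R.ew (.inr (.inl i))) * h (R.eh (.inl i))) +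
        w (R.ew (.inr (.inr (.inl ()))))) := by
  rw [PSDEBNN.fh, R.region_one ht]
  change (∑ j : Fin 1, (R.net.slot 1 (Sum.inr (Sum.inl (k, j)))).elim 0 (fun k => w k) *
    σ ((∑ l, (R.net.slot 1 (Sum.inl (Sum.inl (j, l)))).elim 0 (fun k => w k) *
        Fin.append (fun _ : Fin 1 => t) (fun i => h i) l) +
      (R.net.slot 1 (Sum.inl (Sum.inr j))).elim 0 (fun k => w k))) +
    (R.net.slot 1 (Sum.inr (Sum.inr k))).elim 0 (fun k => w k) = _
  have h1 : R.net.slot 1 (Sum.inr (Sum.inr k)) = none := R.slot_one_eq_none (by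
    rintro (i | i | i) <;> intro hc
    · exact Sum.inl_ne_inr hc
    · exact Sum.inl_ne_inr hc
    · exact Sum.inl_ne_inr (Sum.inr_injective hc))
  have h2 : R.net.slot 1 (Sum.inl (Sum.inr (0 : Fin 1))) = some (R.ew (.inr (.inr (.inl ())))) :=
    PEquiv.ofEmbeddings_apply R.neuronEmb (Function.Embedding.inr.trans R.ew) (.inr (.inl ()))
  have h3 : ∀ l : Fin 1, R.net.slot 1 (Sum.inl (Sum.inl ((0 : Fin 1), Fin.castAdd dh l))) = none :=
    fun l => R.slot_one_eq_none (by
      rintro (i | i | i) <;> intro hc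
      · have h4 := congrArg Prod.snd (Sum.inl_injective (Sum.inl_injective hc))
        have h5 := congrArg Fin.val h4
        simp only [Fin.val_natAdd, Fin.val_castAdd] at h5
        omega
      · exact Sum.inr_ne_inl (Sum.inl_injective hc)
      · exact Sum.inr_ne_inl hc)
  have h4 : ∑ l, (R.net.slot 1 (Sum.inl (Sum.inl ((0 : Fin 1), l)))).elim 0 (fun k => w k) *
      Fin.append (fun _ : Fin 1 => t) (fun i => h i) l =
      ∑ i, w (R.ew (.inr (.inl i))) * h (R.eh (.inl i)) := by
    rw [Fin.sum_univ_add]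
    simp only [h3, Option.elim_none, zero_mul, Finset.sum_const_zero, zero_add, Fin.append_right]
    symm
    refine Fintype.sum_of_injective (fun i => R.eh (.inl i))
      (R.eh.injective.comp Sum.inl_injective) _ _ (fun l hl => ?_) fun i => ?_
    · have h4 : R.net.slot 1 (Sum.inl (Sum.inl ((0 : Fin 1), Fin.natAdd 1 l))) = none :=
        R.slot_one_eq_none (by
          rintro (i | i | i) <;> intro hc
          · have h4 := congrArg Prod.snd (Sum.inl_injective (Sum.inl_injective hc))
            exact hl ⟨i, (Fin.natAdd_inj 1).1 h4⟩
          · exact Sum.inr_ne_inl (Sum.inl_injective hc)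
          · exact Sum.inr_ne_inl hc)
      rw [h4, Option.elim_none, zero_mul]
    · rw [slot_one_natAdd, Option.elim_some]
  rw [Fin.sum_univ_one, h1, h2, h4, Option.elim_none, Option.elim_some, add_zero]

theorem net_fh_one {t : ℝ} (ht : t ∈ Set.Ico R.τ₁ R.τ₂) (h : Euc dh) (w : Euc dw) (j : Fin dy) :
    R.net.fh σ t h w (R.eh (.inr j)) = w (R.ew (.inr (.inr (.inr j)))) *
      σ ((∑ i, w (R.ew (.inr (.inl i))) * h (R.eh (.inl i))) +
        w (R.ew (.inr (.inr (.inl ()))))) := by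
  have h1 : R.net.slot 1 (Sum.inr (Sum.inl (R.eh (.inr j), (0 : Fin 1)))) =
      some (R.ew (.inr (.inr (.inr j)))) :=
    PEquiv.ofEmbeddings_apply R.neuronEmb (Function.Embedding.inr.trans R.ew) (.inr (.inr j))
  rw [R.net_fh_one_eq σ ht, h1, Option.elim_some]

theorem net_fh_one_of_ne {t : ℝ} (ht : t ∈ Set.Ico R.τ₁ R.τ₂) (h : Euc dh) (w : Euc dw) {k : Fin dh}
    (hk : ∀ j, R.eh (.inr j) ≠ k) : R.net.fh σ t h w k = 0 := by
  have h1 : R.net.slot 1 (Sum.inr (Sum.inl (k, (0 : Fin 1)))) = none := R.slot_one_eq_none (by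
    rintro (i | i | i) <;> intro hc
    · exact Sum.inl_ne_inr hc
    · exact Sum.inl_ne_inr hc
    · exact hk i (congrArg Prod.fst (Sum.inl_injective (Sum.inr_injective hc))))
  rw [R.net_fh_one_eq σ ht, h1, Option.elim_none, zero_mul]

theorem net_fq_zero {t : ℝ} (ht : t ∉ Set.Ico R.τ₁ R.τ₂) (w : Euc dw) : R.net.fq σ t w = 0 := by
  rw [PSDEBNN.fq]
  rcases lt_or_ge t R.τ₁ with h1 | h1
  · rw [R.region_zero h1]
    ext k
    change (∑ j, (0 : ℝ) * _) + (0 : ℝ) = 0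
    simp
  · rw [R.region_two (not_lt.1 fun h2 => ht ⟨h1, h2⟩)]
    ext k
    change (∑ j, (0 : ℝ) * _) + (0 : ℝ) = 0
    simp

theorem net_fq_one {t : ℝ} (ht : t ∈ Set.Ico R.τ₁ R.τ₂) (w : Euc dw) :
    R.net.fq σ t w = WithLp.toLp 2 fun k => ∑ r, Function.extend R.ew (Sum.elim 0 R.C) 0 k r *
      σ (R.A r * t + R.D r) := by
  rw [PSDEBNN.fq, R.region_one ht]
  ext k
  change (∑ r, Function.extend R.ew (Sum.elim 0 R.C) 0 k r * σ ((∑ j,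
    (if j = Fin.castAdd dw (0 : Fin 1) then R.A r else 0) * _) + R.D r)) + (0 : ℝ) = _
  simp [Fin.append_left]

end NoiseReadout

/-! ### Explicit solution of the dynamics -/

theorem euc_intervalIntegral_apply {n : ℕ} {f : ℝ → Euc n} {a b : ℝ}
    (hf : IntervalIntegrable f volume a b) (k : Fin n) :
    (∫ s in a..b, f s) k = ∫ s in a..b, f s k :=
  ((EuclideanSpace.proj (𝕜 := ℝ) k).intervalIntegral_comp_comm hf).symm

theorem intervalIntegral_indicator_Ico {f : ℝ → ℝ} {a b c d : ℝ} (hab : a ≤ b)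
    (h : max a c ≤ min b d) :
    ∫ s in a..b, (Set.Ico c d).indicator f s = ∫ s in max a c..min b d, f s := by
  rw [intervalIntegral.integral_of_le hab, setIntegral_indicator measurableSet_Ico,
    intervalIntegral.integral_of_le h, ← Set.Ioc_inter_Ioc]
  exact setIntegral_congr_set ((Filter.EventuallyEq.refl _ _).inter Ico_ae_eq_Ioc)

theorem intervalIntegrable_indicator_Ico {E : Type*} [NormedAddCommGroup E] {f : ℝ → E}
    (hf : Continuous f) (a b c d : ℝ) :
    IntervalIntegrable ((Set.Ico c d).indicator f) volume a b := by
  rw [intervalIntegrable_iff]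
  exact (intervalIntegrable_iff.1 (hf.intervalIntegrable a b)).indicator measurableSet_Ico

namespace NoiseReadout

variable {dx m dy dh dw : ℕ} (R : NoiseReadout dx m dy dh dw) (σ : ℝ → ℝ) (t₁ t₂ : ℝ)
  (b : ℝ≥0 → Euc dw)

/-- The drift of the weights. -/
noncomputable def weightDrift : ℝ → Euc dw :=
  (Set.Ico R.τ₁ R.τ₂).indicator fun t =>
    WithLp.toLp 2 fun k => ∑ r, Function.extend R.ew (Sum.elim 0 R.C) 0 k r *
      σ (R.A r * t + R.D r)

/-- The weights before the end of the stochastic interval. -/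
noncomputable def weightPath (t : ℝ) : Euc dw :=
  R.net.w₀ + (∫ s in (0 : ℝ)..t, R.weightDrift σ s) + R.net.noise t₁ t₂ b t

/-- The coordinates of the weights which carry the noise. -/
noncomputable def noiseCoord (i : Fin m) (t : ℝ) : ℝ :=
  R.scale * (b (min t t₂).toNNReal (R.ew (.inl i)) - b (min t t₁).toNNReal (R.ew (.inl i)))

/-- The coordinates of the weights which carry parameters of the hidden neuron. -/
noncomputable def neuronWeight (t : ℝ) (q : (Fin dx ⊕ Fin m) ⊕ Unit ⊕ Fin dy) : ℝ :=
  R.γ₀ q + ∫ s in R.τ₁..t, ∑ r, R.C q r * σ (R.A r * s + R.D r)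

/-- The accumulated noise and the input, as seen by the hidden neuron. -/
noncomputable def features (x : Euc dx) : Fin dx ⊕ Fin m → ℝ :=
  Sum.elim (fun j => x j) fun i => ∫ s in (0 : ℝ)..R.τ₁, R.noiseCoord t₁ t₂ b i s

/-- The output of the hidden neuron with weights of time `t`. -/
noncomputable def neuronOutput (x : Euc dx) (j : Fin dy) (t : ℝ) : ℝ :=
  R.neuronWeight σ t (.inr (.inr j)) * σ ((∑ i, R.neuronWeight σ t (.inl i) *
    R.features t₁ t₂ b x i) + R.neuronWeight σ t (.inr (.inl ())))

/-- The drift of the hidden state. -/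
noncomputable def hiddenDrift (x : Euc dx) (t : ℝ) : Euc dh :=
  (Set.Ico 0 R.τ₁).indicator (fun t => WithLp.toLp 2 (Function.extend R.eh
      (Sum.elim (Sum.elim (fun _ => 0) fun i => R.noiseCoord t₁ t₂ b i t) fun _ => 0) 0)) t +
    (Set.Ico R.τ₁ R.τ₂).indicator (fun t => WithLp.toLp 2 (Function.extend R.eh
      (Sum.elim (fun _ => 0) fun j => R.neuronOutput σ t₁ t₂ b x j t) 0)) t

/-- The final hidden state. -/
noncomputable def finalState (x : Euc dx) : Euc dh :=
  R.net.a x + ∫ s in (0 : ℝ)..1, R.hiddenDrift σ t₁ t₂ b x s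

theorem net_fq (t : ℝ) (w : Euc dw) : R.net.fq σ t w = R.weightDrift σ t := by
  by_cases ht : t ∈ Set.Ico R.τ₁ R.τ₂
  · rw [R.net_fq_one σ ht, weightDrift, Set.indicator_of_mem ht]
  · rw [R.net_fq_zero σ ht, weightDrift, Set.indicator_of_notMem ht]

theorem net_noise (t : ℝ) (q) : R.net.noise t₁ t₂ b t (R.ew q) =
    Sum.elim (fun i => R.noiseCoord t₁ t₂ b i t) (fun _ => 0) q := by
  have h : R.net.noise t₁ t₂ b t (R.ew q) =
      Function.extend R.ew (Sum.elim (fun _ => R.scale) 0) (0 : Fin dw → ℝ) (R.ew q) *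
        (b (min t t₂).toNNReal (R.ew q) - b (min t t₁).toNNReal (R.ew q)) := by
    exact Matrix.mulVec_diagonal (Function.extend R.ew (Sum.elim (fun _ => R.scale) 0) 0)
      (b (min t t₂).toNNReal - b (min t t₁).toNNReal).ofLp (R.ew q)
  rw [h, R.ew.injective.extend_apply]
  rcases q with i | q
  · rfl
  · simp

variable {σ t₁ t₂ b}

theorem intervalIntegrable_weightDrift (hσ : Continuous σ) (s t : ℝ) :
    IntervalIntegrable (R.weightDrift σ) volume s t :=
  intervalIntegrable_indicator_Ico (by fun_prop) _ _ _ _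

theorem weightDrift_apply (t : ℝ) (q) : R.weightDrift σ t (R.ew q) =
    (Set.Ico R.τ₁ R.τ₂).indicator (fun t => Sum.elim (fun _ => 0)
      (fun q => ∑ r, R.C q r * σ (R.A r * t + R.D r)) q) t := by
  by_cases ht : t ∈ Set.Ico R.τ₁ R.τ₂
  · rw [weightDrift, Set.indicator_of_mem ht, Set.indicator_of_mem ht]
    simp only [R.ew.injective.extend_apply]
    rcases q with i | q
    · simp
    · rfl
  · rw [weightDrift, Set.indicator_of_notMem ht, Set.indicator_of_notMem ht]
    rfl

theorem weightPath_inl (hσ : Continuous σ) (t : ℝ) (i : Fin m) :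
    R.weightPath σ t₁ t₂ b t (R.ew (.inl i)) = R.noiseCoord t₁ t₂ b i t := by
  rw [weightPath, PiLp.add_apply, PiLp.add_apply, R.net_w₀, R.net_noise,
    euc_intervalIntegral_apply (R.intervalIntegrable_weightDrift hσ _ _)]
  simp [weightDrift_apply]

theorem weightPath_inr (hσ : Continuous σ) {t : ℝ} (ht : t ∈ Set.Icc R.τ₁ R.τ₂) (q) :
    R.weightPath σ t₁ t₂ b t (R.ew (.inr q)) = R.neuronWeight σ t q := by
  rw [weightPath, PiLp.add_apply, PiLp.add_apply, R.net_w₀, R.net_noise,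
    euc_intervalIntegral_apply (R.intervalIntegrable_weightDrift hσ _ _)]
  simp only [weightDrift_apply, Sum.elim_inr, add_zero, neuronWeight]
  have h0 := R.zero_lt_τ₁.le
  rw [intervalIntegral_indicator_Ico (h0.trans ht.1), max_eq_right h0, min_eq_left ht.2]
  rw [max_eq_right h0, min_eq_left ht.2]
  exact ht.1

theorem continuous_noiseCoord (hb : Continuous b) (i : Fin m) :
    Continuous (R.noiseCoord t₁ t₂ b i) := by
  unfold noiseCoord
  fun_prop

theorem continuous_neuronWeight (hσ : Continuous σ) (q) :
    Continuous fun t => R.neuronWeight σ t q :=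
  continuous_const.add (intervalIntegral.continuous_primitive
    (fun a b => Continuous.intervalIntegrable (by fun_prop) a b) _)

theorem continuous_neuronOutput (hσ : Continuous σ) (x : Euc dx) (j : Fin dy) :
    Continuous (R.neuronOutput σ t₁ t₂ b x j) := by
  have := R.continuous_neuronWeight hσ
  unfold neuronOutput
  fun_prop

theorem continuous_extend {α β : Type*} {e : α → β} {F : ℝ → α → ℝ}
    (hF : ∀ q, Continuous fun t => F t q) (k : β) :
    Continuous fun t => Function.extend e (F t) 0 k := by
  classical
  by_cases h : ∃ a, e a = k
  · simp only [Function.extend_def, dif_pos h]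
    exact hF _
  · simp only [Function.extend_def, dif_neg h]
    exact continuous_const

theorem intervalIntegrable_hiddenDrift (hσ : Continuous σ) (hb : Continuous b) (x : Euc dx)
    (s t : ℝ) : IntervalIntegrable (R.hiddenDrift σ t₁ t₂ b x) volume s t := by
  refine (intervalIntegrable_indicator_Ico ?_ _ _ _ _).add
    (intervalIntegrable_indicator_Ico ?_ _ _ _ _)
  · refine (PiLp.continuous_toLp 2 _).comp (continuous_pi fun k => continuous_extend ?_ k)
    rintro ((j | i) | j)
    · exact continuous_const
    · exact R.continuous_noiseCoord hb i
    · exact continuous_const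
  · refine (PiLp.continuous_toLp 2 _).comp (continuous_pi fun k => continuous_extend ?_ k)
    rintro (j | j)
    · exact continuous_const
    · exact R.continuous_neuronOutput hσ x j

theorem hiddenDrift_apply (x : Euc dx) (t : ℝ) (q) : R.hiddenDrift σ t₁ t₂ b x t (R.eh q) =
    (Set.Ico 0 R.τ₁).indicator (fun t =>
      Sum.elim (Sum.elim (fun _ => 0) fun i => R.noiseCoord t₁ t₂ b i t) (fun _ => 0) q) t +
    (Set.Ico R.τ₁ R.τ₂).indicator (fun t =>
      Sum.elim (fun _ => 0) (fun j => R.neuronOutput σ t₁ t₂ b x j t) q) t := by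
  simp only [hiddenDrift, PiLp.add_apply, Set.indicator_apply]
  congr 1 <;> split_ifs <;> simp [R.eh.injective.extend_apply]

theorem hiddenDrift_apply_of_notMem (x : Euc dx) (t : ℝ) {k : Fin dh} (hk : ¬ ∃ q, R.eh q = k) :
    R.hiddenDrift σ t₁ t₂ b x t k = 0 := by
  simp only [hiddenDrift, PiLp.add_apply, Set.indicator_apply]
  split_ifs <;> simp [Function.extend_apply' _ _ _ hk]

/-- Along the weights `weightPath`, the drift of the hidden state is `hiddenDrift`. -/
theorem net_fh_eq_hiddenDrift (hσ : Continuous σ) {x : Euc dx} {t : ℝ} (ht : 0 ≤ t) {h : Euc dh}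
    {w : Euc dw} (hw : t < R.τ₂ → w = R.weightPath σ t₁ t₂ b t)
    (hh : R.τ₁ ≤ t → ∀ i, h (R.eh (.inl i)) = R.features t₁ t₂ b x i) :
    R.net.fh σ t h w = R.hiddenDrift σ t₁ t₂ b x t := by
  rcases lt_or_ge t R.τ₁ with h1 | h1
  · have h0 : t ∈ Set.Ico 0 R.τ₁ := ⟨ht, h1⟩
    have h0' : t ∉ Set.Ico R.τ₁ R.τ₂ := fun h => not_lt.2 h.1 h1
    have hw' := hw (h1.trans R.τ₁_lt_τ₂)
    ext k
    by_cases hk : ∃ q, R.eh q = k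
    · obtain ⟨q, rfl⟩ := hk
      rw [hiddenDrift_apply, Set.indicator_of_mem h0, Set.indicator_of_notMem h0', add_zero]
      rcases q with (j | i) | j
      · exact R.net_fh_zero_of_ne σ h1 h w (by simp)
      · rw [R.net_fh_zero σ h1, hw', R.weightPath_inl hσ]
        rfl
      · exact R.net_fh_zero_of_ne σ h1 h w (by simp)
    · rw [hiddenDrift_apply_of_notMem R x t hk]
      exact R.net_fh_zero_of_ne σ h1 h w fun i hi => hk ⟨_, hi⟩
  · have h0 : t ∉ Set.Ico 0 R.τ₁ := fun h => not_lt.2 h1 h.2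
    rcases lt_or_ge t R.τ₂ with h2 | h2
    · have h0' : t ∈ Set.Ico R.τ₁ R.τ₂ := ⟨h1, h2⟩
      ext k
      by_cases hk : ∃ q, R.eh q = k
      · obtain ⟨q, rfl⟩ := hk
        rw [hiddenDrift_apply, Set.indicator_of_mem h0', Set.indicator_of_notMem h0, zero_add]
        rcases q with j | j
        · exact R.net_fh_one_of_ne σ h0' h w (by simp)
        · rw [R.net_fh_one σ h0', hw h2]
          simp only [R.weightPath_inr hσ ⟨h1, h2.le⟩, hh h1]
          rfl
      · rw [hiddenDrift_apply_of_notMem R x t hk]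
        exact R.net_fh_one_of_ne σ h0' h w fun i hi => hk ⟨_, hi⟩
    · have h0' : t ∉ Set.Ico R.τ₁ R.τ₂ := fun h => not_lt.2 h2 h.2
      rw [R.net_fh_two σ h2, hiddenDrift, Set.indicator_of_notMem h0, Set.indicator_of_notMem h0',
        add_zero]

/-- Leaving the integrand `G` arbitrary makes this serve both an unknown solution (uniqueness) and
the explicit one (existence). -/
theorem features_of_integral_eq {x : Euc dx} {G h : ℝ → Euc dh}
    (hG : IntervalIntegrable G volume 0 1)
    (hh : ∀ t ∈ Set.Icc (0 : ℝ) 1, h t = R.net.a x + ∫ s in (0 : ℝ)..t, G s)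
    (hGi : ∀ t ∈ Set.Icc (0 : ℝ) 1, ∀ i, G t (R.eh (.inl i)) = (Set.Ico 0 R.τ₁).indicator
      (fun t => Sum.elim (fun _ => 0) (fun i => R.noiseCoord t₁ t₂ b i t) i) t)
    {t : ℝ} (ht : t ∈ Set.Icc R.τ₁ 1) (i) : h t (R.eh (.inl i)) = R.features t₁ t₂ b x i := by
  have h0 := R.zero_lt_τ₁.le
  have ht0 : 0 ≤ t := h0.trans ht.1
  have hGt : IntervalIntegrable G volume 0 t := hG.mono_set (by
    rw [Set.uIcc_of_le ht0, Set.uIcc_of_le zero_le_one]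
    exact Set.Icc_subset_Icc_right ht.2)
  rw [hh t ⟨ht0, ht.2⟩, PiLp.add_apply, euc_intervalIntegral_apply hGt,
    intervalIntegral.integral_congr (g := (Set.Ico 0 R.τ₁).indicator
      (fun t => Sum.elim (fun _ => 0) (fun i => R.noiseCoord t₁ t₂ b i t) i)) fun s hs => ?_,
    intervalIntegral_indicator_Ico ht0, max_self, min_eq_right ht.1]
  · rcases i with j | i
    · rw [R.net_a_inl_inl]
      simp [features]
    · rw [R.net_a_of_ne x (by simp)]
      simp [features]
  · rwa [max_self, min_eq_right ht.1]
  · rw [Set.uIcc_of_le ht0] at hs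
    exact hGi s ⟨hs.1, hs.2.trans ht.2⟩ i

theorem weightEq_eq_weightPath {reset : Option (Euc dw)} {w : ℝ → Euc dw} (ht₂ : t₂ ≤ 1)
    (hw : R.net.WeightEq σ t₁ t₂ b w reset) {t : ℝ} (ht : t ∈ Set.Ico 0 t₂) :
    w t = R.weightPath σ t₁ t₂ b t := by
  cases reset with
  | none =>
    have h := hw t ⟨ht.1, ht.2.le.trans ht₂⟩
    simp only [net_fq] at h
    exact h
  | some v =>
    have h := hw.1 t ht
    simp only [net_fq] at h
    exact h

theorem exists_weightEq (reset : Option (Euc dw)) :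
    ∃ w : ℝ → Euc dw, R.net.WeightEq σ t₁ t₂ b w reset := by
  cases reset with
  | none =>
    refine ⟨R.weightPath σ t₁ t₂ b, fun t _ => ?_⟩
    simp only [net_fq]
    rfl
  | some v =>
    refine ⟨fun t => if t < t₂ then R.weightPath σ t₁ t₂ b t else
      v + ∫ s in t₂..t, R.weightDrift σ s, fun t ht => ?_, fun t ht => ?_⟩
    · simp only [net_fq, if_pos ht.2]
      rfl
    · simp only [net_fq, if_neg (not_lt.2 ht.1)]

/-- The system is triangular, so plain integration solves it and no Grönwall estimate is needed:
`f_q` ignores `w`, the features evolve independently of `h` and freeze at `τ₁`, and the outputs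
depend only on the features. The reset occurs after `τ₂`, where `f_h` vanishes. -/
theorem exists_isSolution_iff (hσ : Continuous σ) (hb : Continuous b) (hτ₂ : R.τ₂ < t₂)
    (ht₂ : t₂ ≤ 1) (reset : Option (Euc dw)) (x : Euc dx) (y : Euc dh) :
    (∃ w h, R.net.IsSolution σ t₁ t₂ reset b x w h ∧ h 1 = y) ↔
      y = R.finalState σ t₁ t₂ b x := by
  constructor
  · rintro ⟨w, h, hs, rfl⟩
    have hw : ∀ t, 0 ≤ t → t < R.τ₂ → w t = R.weightPath σ t₁ t₂ b t := fun t h0 h1 =>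
      R.weightEq_eq_weightPath ht₂ hs.weight_eq ⟨h0, h1.trans hτ₂⟩
    have hfeat : ∀ t ∈ Set.Icc R.τ₁ 1, ∀ i, h t (R.eh (.inl i)) = R.features t₁ t₂ b x i := by
      intro t ht i
      refine R.features_of_integral_eq hs.integrable_fh hs.hidden_eq (fun s hs' i => ?_) ht i
      rcases lt_or_ge s R.τ₁ with h1 | h1
      · have h0 : s ∈ Set.Ico 0 R.τ₁ := ⟨hs'.1, h1⟩
        rw [Set.indicator_of_mem h0]
        rcases i with j | i
        · exact R.net_fh_zero_of_ne σ h1 _ _ (by simp)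
        · rw [R.net_fh_zero σ h1, hw s hs'.1 (h1.trans R.τ₁_lt_τ₂), R.weightPath_inl hσ]
          rfl
      · rw [Set.indicator_of_notMem fun h => not_lt.2 h1 h.2]
        rcases lt_or_ge s R.τ₂ with h2 | h2
        · exact R.net_fh_one_of_ne σ ⟨h1, h2⟩ _ _ (by simp)
        · rw [R.net_fh_two σ h2]
          rfl
    rw [hs.hidden_eq 1 ⟨zero_le_one, le_rfl⟩, finalState]
    congr 1
    refine intervalIntegral.integral_congr fun t ht => ?_
    rw [Set.uIcc_of_le zero_le_one] at ht
    exact R.net_fh_eq_hiddenDrift hσ ht.1 (hw t ht.1) fun h1 => hfeat t ⟨h1, ht.2⟩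
  · rintro rfl
    obtain ⟨w, hw⟩ := R.exists_weightEq (σ := σ) (t₁ := t₁) (t₂ := t₂) (b := b) reset
    let h : ℝ → Euc dh := fun t => R.net.a x + ∫ s in (0 : ℝ)..t, R.hiddenDrift σ t₁ t₂ b x s
    have hint := R.intervalIntegrable_hiddenDrift (t₁ := t₁) (t₂ := t₂) hσ hb x
    have hfeat : ∀ t ∈ Set.Icc R.τ₁ 1, ∀ i, h t (R.eh (.inl i)) = R.features t₁ t₂ b x i := by
      intro t ht i
      refine R.features_of_integral_eq (hint 0 1) (fun _ _ => rfl) (fun s _ i => ?_) ht i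
      rw [hiddenDrift_apply]
      simp
    have hfh : ∀ t ∈ Set.Icc (0 : ℝ) 1,
        R.net.fh σ t (h t) (w t) = R.hiddenDrift σ t₁ t₂ b x t := fun t ht =>
      R.net_fh_eq_hiddenDrift hσ ht.1
        (fun h1 => R.weightEq_eq_weightPath ht₂ hw ⟨ht.1, h1.trans hτ₂⟩)
        fun h1 => hfeat t ⟨h1, ht.2⟩
    refine ⟨w, h, ⟨?_, ?_, hw, fun t ht => ?_⟩, rfl⟩
    · simp only [net_fq]
      exact R.intervalIntegrable_weightDrift hσ 0 1
    · refine (hint 0 1).congr fun t ht => ?_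
      rw [Set.uIoc_of_le zero_le_one] at ht
      exact (hfh t ⟨ht.1.le, ht.2⟩).symm
    · simp only [h]
      congr 1
      refine intervalIntegral.integral_congr fun s hs => ?_
      rw [Set.uIcc_of_le ht.1] at hs
      exact (hfh s ⟨hs.1, hs.2.trans ht.2⟩).symm

theorem finalState_apply (hσ : Continuous σ) (hb : Continuous b) (x : Euc dx) (j : Fin dy) :
    R.finalState σ t₁ t₂ b x (R.eh (.inr j)) =
      ∫ t in R.τ₁..R.τ₂, R.neuronOutput σ t₁ t₂ b x j t := by
  have h0 := R.zero_lt_τ₁.le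
  have h1 := R.τ₁_lt_τ₂.le
  have h2 := R.τ₂_lt_one.le
  rw [finalState, PiLp.add_apply, R.net_a_of_ne x (by simp), zero_add,
    euc_intervalIntegral_apply (R.intervalIntegrable_hiddenDrift hσ hb x 0 1)]
  simp only [hiddenDrift_apply, Sum.elim_inr, Set.indicator_zero, zero_add]
  rw [intervalIntegral_indicator_Ico zero_le_one, max_eq_right h0, min_eq_right h2]
  rwa [max_eq_right h0, min_eq_right h2]

theorem features_eq_pathNoise (hb : Continuous b) (ht₁ : 0 ≤ t₁) (hτ₁ : t₁ < R.τ₁)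
    (ht₂ : R.τ₁ ≤ t₂) (hs : R.scale = (√((R.τ₁ - t₁) ^ 3 / 3))⁻¹) (x : Euc dx) :
    R.features t₁ t₂ b x = Sum.elim (fun j => x j) fun i =>
      pathNoise (fun i => R.ew (.inl i)) t₁ (R.τ₁ - t₁) b i := by
  unfold features
  congr 1
  funext i
  have hc := R.continuous_noiseCoord (t₁ := t₁) (t₂ := t₂) hb i
  rw [← intervalIntegral.integral_add_adjacent_intervals (b := t₁) (hc.intervalIntegrable _ _)
    (hc.intervalIntegrable _ _)]
  -- Before `t₁` both truncated times equal `s`, so the increment is zero.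
  have e1 : ∫ s in (0 : ℝ)..t₁, R.noiseCoord t₁ t₂ b i s = 0 := by
    rw [intervalIntegral.integral_congr (g := fun _ => 0) fun s hs => ?_]
    · simp
    · rw [Set.uIcc_of_le ht₁] at hs
      simp [noiseCoord, min_eq_left hs.2, min_eq_left (hs.2.trans (hτ₁.le.trans ht₂))]
  have e2 : ∫ s in t₁..R.τ₁, R.noiseCoord t₁ t₂ b i s = R.scale *
      ∫ s in t₁..R.τ₁, (b s.toNNReal (R.ew (.inl i)) - b t₁.toNNReal (R.ew (.inl i))) := by
    rw [← intervalIntegral.integral_const_mul]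
    refine intervalIntegral.integral_congr fun s hs => ?_
    rw [Set.uIcc_of_le hτ₁.le] at hs
    simp only [noiseCoord, min_eq_right hs.1, min_eq_left (hs.2.trans ht₂)]
  have e3 := incrementIntegral_eq (p := fun s => b s (R.ew (.inl i))) ht₁ (sub_pos.2 hτ₁).le
    (by fun_prop)
  rw [add_sub_cancel] at e3
  rw [e1, e2, zero_add, hs, ← e3]
  rfl

end NoiseReadout

/-! ### Assembly of the approximation theorem -/

theorem exists_measure_norm_le {Ω : Type*} [MeasurableSpace Ω] (P : Measure Ω)
    [IsProbabilityMeasure P] {n : ℕ} (η : Ω → Euc n) {ε : ℝ} (hε : 0 < ε) :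
    ∃ r : ℝ, 1 - ε ≤ P.real {ω | ‖η ω‖ ≤ r} := by
  have h := tendsto_measure_iUnion_atTop (μ := P) (s := fun n : ℕ => {ω | ‖η ω‖ ≤ n})
    fun i j hij ω (hω : ‖η ω‖ ≤ i) => hω.trans (by exact_mod_cast hij)
  have hu : ⋃ n : ℕ, {ω | ‖η ω‖ ≤ n} = Set.univ :=
    Set.eq_univ_of_forall fun ω => Set.mem_iUnion.2 (exists_nat_ge ‖η ω‖)
  rw [hu, measure_univ] at h
  have h' := (ENNReal.tendsto_toReal ENNReal.one_ne_top).comp h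
  obtain ⟨k, hk⟩ := (h'.eventually (lt_mem_nhds (show 1 - ε < (1 : ENNReal).toReal by simpa))).exists
  exact ⟨k, hk.le⟩

theorem euc_norm_le_of_forall {n : ℕ} {v : Euc n} {ε : ℝ} (hε : 0 ≤ ε)
    (h : ∀ j, |v j| ≤ ε / (n + 1)) : ‖v‖ ≤ ε := by
  have h1 : ‖v‖ ≤ ∑ j, |v j| := by
    rw [EuclideanSpace.norm_eq]
    refine Real.sqrt_le_iff.2 ⟨Finset.sum_nonneg fun j _ => abs_nonneg _, ?_⟩
    simp only [Real.norm_eq_abs]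
    exact Finset.sum_sq_le_sq_sum_of_nonneg fun j _ => abs_nonneg _
  refine h1.trans ((Finset.sum_le_sum fun j _ => h j).trans ?_)
  rw [Finset.sum_const, Finset.card_univ, Fintype.card_fin, nsmul_eq_mul, ← mul_div_assoc,
    div_le_iff₀ (by positivity)]
  nlinarith

theorem map_generator_eq {Ω : Type*} [MeasurableSpace Ω] {P : Measure Ω} [IsProbabilityMeasure P]
    {dx dy m : ℕ} {𝒳 : Set (Euc dx)} {𝒴 : Set (Euc dy)} {X : Ω → 𝒳} (hX : Measurable X)
    {Y : Ω → 𝒴} {f : Euc m × 𝒳 → 𝒴} (hf : Continuous f) (hgen : IsGenerator P X Y f)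
    {η : Ω → Euc m} (hη : Measurable η) (hlaw : P.map η = stdGaussian (Euc m))
    (hind : IndepFun η X P) :
    P.map (fun ω => (X ω, f (η ω, X ω))) = P.map (fun ω => (X ω, Y ω)) := by
  have h1 := (indepFun_iff_map_prod_eq_prod_map_map hX.aemeasurable hη.aemeasurable).1 hind.symm
  have hfm := hf.measurable
  rw [← hgen, ← hlaw, ← h1, Measure.map_map (by fun_prop) (by fun_prop)]
  rfl

namespace NoiseReadout

variable {dx m dy dh dw : ℕ}

/-- The readout of the output coordinates. -/
noncomputable def readout (R : NoiseReadout dx m dy dh dw) : Euc dh →ₗ[ℝ] Euc dy :=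
  (WithLp.linearEquiv 2 ℝ (Fin dy → ℝ)).symm.toLinearMap ∘ₗ
    LinearMap.funLeft ℝ ℝ (fun j => R.eh (.inr j)) ∘ₗ
      (WithLp.linearEquiv 2 ℝ (Fin dh → ℝ)).toLinearMap

theorem readout_apply (R : NoiseReadout dx m dy dh dw) (h : Euc dh) (j : Fin dy) :
    R.readout h j = h (R.eh (.inr j)) := rfl

/-- Some network approximates a continuous function of the noise and the input on a compact set. -/
theorem exists_norm_readout_sub_le {σ : ℝ → ℝ} (hσ : Continuous σ)
    (hσ' : ¬ ∃ p : Polynomial ℝ, ∀ s, σ s = p.eval s)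
    {𝒳 : Set (Euc dx)} (h𝒳 : IsCompact 𝒳) {f : Euc m × 𝒳 → Euc dy} (hf : Continuous f)
    (eh : (Fin dx ⊕ Fin m) ⊕ Fin dy ↪ Fin dh)
    (ew : Fin m ⊕ ((Fin dx ⊕ Fin m) ⊕ Unit ⊕ Fin dy) ↪ Fin dw) {t₁ τ₁ τ₂ t₂ : ℝ} (ht₁ : 0 ≤ t₁)
    (h₁ : t₁ < τ₁) (h₂ : τ₁ < τ₂) (h₃ : τ₂ < t₂) (ht₂ : t₂ ≤ 1) (r : ℝ) {ε : ℝ} (hε : 0 < ε) :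
    ∃ R : NoiseReadout dx m dy dh dw, R.τ₂ < t₂ ∧ ∀ b : ℝ≥0 → Euc dw, Continuous b →
      ‖pathNoise (fun i => ew (.inl i)) t₁ (τ₁ - t₁) b‖ ≤ r → ∀ x : 𝒳,
        ‖R.readout (R.finalState σ t₁ t₂ b x) -
          f (pathNoise (fun i => ew (.inl i)) t₁ (τ₁ - t₁) b, x)‖ ≤ ε := by
  have : CompactSpace 𝒳 := isCompact_iff_compactSpace.1 h𝒳
  -- Truncating the noise to a ball provides the compact domain needed for uniform approximation.
  have : CompactSpace (Metric.closedBall (0 : Euc m) r) :=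
    isCompact_iff_compactSpace.1 (isCompact_closedBall _ _)
  let u : C(Metric.closedBall (0 : Euc m) r × 𝒳, Fin dx ⊕ Fin m → ℝ) :=
    ⟨fun k => Sum.elim (fun j => (k.2 : Euc dx) j) fun i => (k.1 : Euc m) i,
      continuous_pi fun i => by rcases i with i | i <;> simp only [Sum.elim_inl, Sum.elim_inr] <;>
        fun_prop⟩
  have hu : Function.Injective u := fun k l hkl => by
    refine Prod.ext (Subtype.ext ?_) (Subtype.ext ?_)
    · ext i
      exact congrFun hkl (.inr i)
    · ext i
      exact congrFun hkl (.inl i)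
  let G : Fin dy → C(Metric.closedBall (0 : Euc m) r × 𝒳, ℝ) := fun j => ⟨fun k => f (k.1, k.2) j, by fun_prop⟩
  obtain ⟨γ₀, N, A, D, C, w, -, hw, happ⟩ := exists_network_weights_readout_near (σ := ⟨σ, hσ⟩)
    hσ' hu G h₂ (show 0 < ε / (dy + 1) by positivity)
  let R : NoiseReadout dx m dy dh dw :=
    { eh, ew, τ₁, τ₂, γ₀, N, A, D, C
      zero_lt_τ₁ := ht₁.trans_lt h₁
      τ₁_lt_τ₂ := h₂
      τ₂_lt_one := h₃.trans_le ht₂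
      scale := (√((τ₁ - t₁) ^ 3 / 3))⁻¹ }
  refine ⟨R, h₃, fun b hb hη x => euc_norm_le_of_forall hε.le fun j => ?_⟩
  have hfeat := R.features_eq_pathNoise hb ht₁ h₁ (h₂.le.trans h₃.le) rfl x
  have h := happ (⟨_, mem_closedBall_zero_iff.2 hη⟩, x) j
  rw [PiLp.sub_apply, readout_apply, R.finalState_apply hσ hb]
  have e : ∀ t, R.neuronOutput σ t₁ t₂ b x j t = w t (.inr (.inr j)) *
      σ ((∑ i, w t (.inl i) * u (⟨_, mem_closedBall_zero_iff.2 hη⟩, x) i) +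
        w t (.inr (.inl ()))) := fun t => by
    simp only [hw]
    rw [neuronOutput, hfeat]
    rfl
  simp only [e]
  exact h

end NoiseReadout

theorem exists_approximable {Ω : Type*} [MeasurableSpace Ω] (P : Measure Ω) [IsProbabilityMeasure P]
    {dx dy m dh dw : ℕ} {𝒳 : Set (Euc dx)} (h𝒳 : IsCompact 𝒳) {𝒴 : Set (Euc dy)}
    {X : Ω → 𝒳} (hX : Measurable X) {Y : Ω → 𝒴}
    {f : Euc m × 𝒳 → 𝒴} (hf : Continuous f) (hgen : IsGenerator P X Y f)
    {σ : ℝ → ℝ} (hσ : Continuous σ) (hσ' : ¬ ∃ p : Polynomial ℝ, ∀ s, σ s = p.eval s)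
    {t₁ t₂ : ℝ} (ht₁ : 0 ≤ t₁) (ht : t₁ < t₂) (ht₂ : t₂ ≤ 1)
    (eh : (Fin dx ⊕ Fin m) ⊕ Fin dy ↪ Fin dh)
    (ew : Fin m ⊕ ((Fin dx ⊕ Fin m) ⊕ Unit ⊕ Fin dy) ↪ Fin dw)
    {B : ℝ≥0 → Ω → Euc dw} (hB : IsBrownianMotion B P)
    (hBX : IndepFun (fun (ω : Ω) (t : ℝ≥0) => B t ω) X P) (reset : Option (Euc dw))
    {ε : ℝ} (hε : 0 < ε) : Approximable P X Y f σ t₁ t₂ dh B reset ε := by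
  let e : Fin m → Fin dw := fun i => ew (.inl i)
  -- Both cut-offs lie strictly inside `(t₁, t₂)`: noise is available before `τ₁`, and the readout
  -- is complete before any reset.
  let τ₁ := t₁ + (t₂ - t₁) / 3
  let τ₂ := t₁ + 2 * (t₂ - t₁) / 3
  have h₁ : t₁ < τ₁ := by simp only [τ₁]; linarith
  have h₂ : τ₁ < τ₂ := by simp only [τ₁, τ₂]; linarith
  have h₃ : τ₂ < t₂ := by simp only [τ₂]; linarith
  let η : Ω → Euc m := fun ω => pathNoise e t₁ (τ₁ - t₁) (B · ω)
  have hη : Measurable η :=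
    (measurable_pathNoise e t₁ (τ₁ - t₁)).comp (measurable_pi_lambda _ hB.measurable)
  have hlaw : P.map η = stdGaussian (Euc m) :=
    hB.map_pathNoise (ew.injective.comp Sum.inl_injective) ht₁ (sub_pos.2 h₁)
  have hind : IndepFun η X P := hBX.comp (measurable_pathNoise e t₁ (τ₁ - t₁)) measurable_id
  obtain ⟨r, hr⟩ := exists_measure_norm_le P η hε
  have hcont : ∀ᵐ ω ∂P, Continuous (B · ω) := by
    filter_upwards [ae_all_iff.2 fun i => (hB.brownian i).cont] with ω hω
    exact (PiLp.continuous_toLp 2 _).comp (continuous_pi hω)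
  -- The bound must hold at every point of a measurable event, so path continuity is secured on a
  -- measurable set of full measure.
  obtain ⟨S, hS, hSm, hSc⟩ := hcont.exists_measurable_mem
  obtain ⟨R, hRτ, hR⟩ := NoiseReadout.exists_norm_readout_sub_le hσ hσ' h𝒳
    (continuous_subtype_val.comp hf) eh ew ht₁ h₁ h₂ h₃ ht₂ r hε
  refine ⟨R.net, R.readout, fun ω x => R.finalState σ t₁ t₂ (B · ω) x, S ∩ {ω | ‖η ω‖ ≤ r}, η,
    ?_, hSm.inter (measurableSet_le hη.norm measurable_const), hη, hlaw, hind,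
    map_generator_eq hX hf hgen hη hlaw hind, ?_, ?_⟩
  · filter_upwards [hcont] with ω hω x y
    exact R.exists_isSolution_iff hσ hω hRτ ht₂ reset x y
  · have hae : (S ∩ {ω | ‖η ω‖ ≤ r} : Set Ω) =ᵐ[P] {ω | ‖η ω‖ ≤ r} := by
      filter_upwards [hS] with ω hω
      exact propext ⟨fun h => h.2, fun h => ⟨hω, h⟩⟩
    rwa [measureReal_congr hae]
  · rintro ω ⟨hωS, hω⟩ x
    exact hR _ (hSc ω hωS) hω x

theorem mainTheorem1 {Ω : Type*} [MeasurableSpace Ω] (P : Measure Ω) [IsProbabilityMeasure P]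
    {dx dy m : ℕ} (hm : dy ≤ m)
    {𝒳 : Set (Euc dx)} (h𝒳 : IsCompact 𝒳) {𝒴 : Set (Euc dy)}
    (X : Ω → 𝒳) (hX : Measurable X) (Y : Ω → 𝒴) (hY : Measurable Y)
    (f : Euc m × 𝒳 → 𝒴) (hf : Continuous f) (hgen : IsGenerator P X Y f)
    (σ : ℝ → ℝ) (hσ : ∃ K : ℝ≥0, LipschitzWith K σ)
    (hσ' : ¬ ∃ p : Polynomial ℝ, ∀ s, σ s = p.eval s)
    (t₁ t₂ : ℝ) (ht₁ : 0 ≤ t₁) (ht : t₁ < t₂) (ht₂ : t₂ ≤ 1) :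
    ∃ Dh Dw : ℕ, ∀ dh ≥ Dh, ∀ dw ≥ Dw,
      ∀ B : ℝ≥0 → Ω → Euc dw, IsBrownianMotion B P →
        IndepFun (fun (ω : Ω) (t : ℝ≥0) => B t ω) X P →
        ∀ ε : ℝ, 0 < ε →
          -- `w_{t₂}` is the output of the SDE
          Approximable P X Y f σ t₁ t₂ dh B none ε ∧
          -- `w_{t₂}` is fixed a priori
          (t₂ < 1 → ∀ v : Euc dw, Approximable P X Y f σ t₁ t₂ dh B (some v) ε) ∧
          -- `w_{t₂}` is a learned parameter
          (t₂ < 1 → ∃ v : Euc dw, Approximable P X Y f σ t₁ t₂ dh B (some v) ε) := by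
  obtain ⟨L, hL⟩ := hσ
  -- Hidden coordinates: input, noise, output. Weight coordinates: noise, inner weights, one bias,
  -- outer weights.
  refine ⟨Fintype.card ((Fin dx ⊕ Fin m) ⊕ Fin dy),
    Fintype.card (Fin m ⊕ ((Fin dx ⊕ Fin m) ⊕ Unit ⊕ Fin dy)),
    fun dh hdh dw hdw B hB hBX ε hε => ?_⟩
  obtain ⟨eh⟩ : Nonempty ((Fin dx ⊕ Fin m) ⊕ Fin dy ↪ Fin dh) :=
    Function.Embedding.nonempty_of_card_le (by rwa [Fintype.card_fin])
  obtain ⟨ew⟩ : Nonempty (Fin m ⊕ ((Fin dx ⊕ Fin m) ⊕ Unit ⊕ Fin dy) ↪ Fin dw) :=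
    Function.Embedding.nonempty_of_card_le (by rwa [Fintype.card_fin])
  have h : ∀ reset, Approximable P X Y f σ t₁ t₂ dh B reset ε := fun reset =>
    exists_approximable P h𝒳 hX hf hgen hL.continuous hσ' ht₁ ht ht₂ eh ew hB hBX reset hε
  exact ⟨h none, fun _ v => h (some v), fun _ => ⟨0, h (some 0)⟩⟩
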